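/- Consider the LTI plant $\dot x = Ax+Bu+B_ww$, $z = Cx+Du+D_ww$ with $x\in\mathbb R^n$, $u\in\mathbb R^m$, $z\in\mathbb R^r$, constant disturbance $w\in\mathcal W\subseteq\mathbb R^{n_w}$ and $A$ Hurwitz, and let $G_u=-CA^{-1}B+D$, $G_w=-CA^{-1}B_w+D_w$. For $w\in\mathcal W$ consider the problem $$\min_{\bar z\in\mathcal Z,\ \bar u\in\mathcal U}\ f_0(\bar u)+g_0(\bar z)\quad\text{subject to}\quad \bar z=G_u\bar u+G_ww,\quad 0=H_z\bar z+H_u\bar u+H_ww,\qquad(\ast)$$ with $n_{\rm c}$ engineering constraints, where $\mathcal U\subseteq\mathbb R^m$, $\mathcal Z\subseteq\mathbb R^r$ are convex sets, $f_0:\mathcal U\to\mathbb R$ and $g_0:\mathcal Z\to\mathbb R$ are convex, and on the interiors of their domains continuously differentiable with locally Lipschitz gradients; $\mathcal W$ is convex and compact, and for every $w\in\mathcal W$ problem $(\ast)$ has an optimal solution with $\bar u\in\operatorname{int}\mathcal U$ and $\bar z\in\operatorname{int}\mathcal Z$. Let $T=\begin{bmatrix}T_z\\T_u\end{bmatrix}\in\mathbb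 R^{(r+m)\times q}$ have full column rank and satisfy $\operatorname{range}T=\operatorname{null}\begin{bmatrix}I_r&-G_u\\H_z&H_u\end{bmatrix}$, let $N=H_zG_u+H_u$ have full row rank, and for each $w\in\mathcal W$ let $(z_0(w),u_0(w))$ satisfy the two affine constraints of $(\ast)$. Assume that for each $w\in\mathcal W$ the function $\xi\mapsto f_0(T_u\xi+u_0(w))+g_0(T_z\xi+z_0(w))$ is strongly convex on $\Xi_w=\{\xi\in\mathbb R^q : T_u\xi+u_0(w)\in\mathcal U,\ T_z\xi+z_0(w)\in\mathcal Z\}$. Then: (i) there is a matrix $K_2\in\mathbb R^{m\times n_{\rm c}}$ such that $-NK_2$ is Hurwitz; (ii) for every $K_2$ with $-NK_2$ Hurwitz and every symmetric $P\succ0$ in $\mathbb R^{q\times q}$, there is a matrix $K_1\in\mathbb R^{m\times q}$ of full column rank with $\Pi_{\rm c}K_1=T_uP$, where $\Pi_{\rm c}=I_m-K_2(NK_2)^{-1}N$; (iii) for every such choice of $K_2,P,K_1$ there are $\tau^\star>0$ and $\rho>0$ such that for all $\tau_2>\tau^\star$ and all $\tau_1>\rho\,\tau_2$ the controller $$\tau_1\dot\eta_1=-T_u^{\mathsf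 T}\nabla f_0(u)-T_z^{\mathsf T}\nabla g_0(z),\qquad \tau_2\dot\eta_2=-(H_zz+H_uu+H_ww),\qquad u=K_1\eta_1+K_2\eta_2$$ solves the optimal steady-state control problem: for each $w\in\mathcal W$, the closed-loop system with state $(x,\eta_1,\eta_2)$, on the set of states where $u\in\operatorname{int}\mathcal U$ and $z\in\operatorname{int}\mathcal Z$, has exactly one equilibrium point, this equilibrium is locally exponentially stable, and the equilibrium values $(\bar z,\bar u)$ of output and input are an optimal point of $(\ast)$. -/

import Mathlib

open Matrix

/-- Real column vectors of length `k`, with the Euclidean norm and inner product. -/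
abbrev Vec (k : ℕ) : Type := EuclideanSpace ℝ (Fin k)

/-- The matrix-vector product on Euclidean spaces. -/
noncomputable abbrev matAct {a b : ℕ} (M : Matrix (Fin a) (Fin b) ℝ) (v : Vec b) : Vec a :=
  Matrix.toEuclideanLin M v

infixr:73 " *ₑ " => matAct

/-- A real square matrix is Hurwitz if all its complex eigenvalues have negative real part. -/
def IsHurwitz {k : ℕ} (M : Matrix (Fin k) (Fin k) ℝ) : Prop :=
  ∀ s ∈ spectrum ℂ (M.map (algebraMap ℝ ℂ)), s.re < 0

/-! ### Ordinary differential equations on an open domain -/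

section ODE

variable {E : Type*} [NormedAddCommGroup E] [NormedSpace ℝ E]

/-- `φ` is a (forward complete) solution of `ẋ = F x` on `[0, ∞)` with values in `Ω`. -/
def IsSolution (F : E → E) (Ω : Set E) (φ : ℝ → E) : Prop :=
  ∀ t, 0 ≤ t → φ t ∈ Ω ∧ HasDerivWithinAt φ (F (φ t)) (Set.Ici 0) t

/-- `p` is an equilibrium point, in the domain `Ω`, of `ẋ = F x`. -/
def IsEquilibrium (F : E → E) (Ω : Set E) (p : E) : Prop :=
  p ∈ Ω ∧ F p = 0

/-- Local exponential stability of the point `p` for `ẋ = F x` on `Ω`: from every initial state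
near `p` there is a solution on `[0, ∞)`, and every such solution converges to `p` exponentially,
with uniform constants. -/
def IsLocallyExpStable (F : E → E) (Ω : Set E) (p : E) : Prop :=
  ∃ δ > 0, ∃ c > 0, ∃ rate > 0, ∀ x₀ : E, ‖x₀ - p‖ < δ →
    (∃ φ, IsSolution F Ω φ ∧ φ 0 = x₀) ∧
    ∀ φ, IsSolution F Ω φ → φ 0 = x₀ →
      ∀ t : ℝ, 0 ≤ t → ‖φ t - p‖ ≤ c * Real.exp (-rate * t) * ‖x₀ - p‖

end ODE

/-! ### Plant and steady-state optimization problem -/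

/-- The matrices of the LTI plant `ẋ = A x + B u + B_w w`, `z = C x + D u + D_w w`. -/
structure Plant (n m r nw : ℕ) where
  A : Matrix (Fin n) (Fin n) ℝ
  B : Matrix (Fin n) (Fin m) ℝ
  Bw : Matrix (Fin n) (Fin nw) ℝ
  C : Matrix (Fin r) (Fin n) ℝ
  D : Matrix (Fin r) (Fin m) ℝ
  Dw : Matrix (Fin r) (Fin nw) ℝ

namespace Plant

variable {n m r nw : ℕ} (S : Plant n m r nw)

/-- DC gain from the input `u` to the output `z`. -/
noncomputable def Gu : Matrix (Fin r) (Fin m) ℝ := -(S.C * S.A⁻¹ * S.B) + S.D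

/-- DC gain from the disturbance `w` to the output `z`. -/
noncomputable def Gw : Matrix (Fin r) (Fin nw) ℝ := -(S.C * S.A⁻¹ * S.Bw) + S.Dw

end Plant

/-- Data of the steady-state optimization problem other than the plant: the domains `U`, `Z` of
the objective functions `f₀`, `g₀` (whose values outside the domains are irrelevant), the set `W`
of disturbances, and the matrices of the engineering constraint
`0 = H_z z + H_u u + H_w w`. -/
structure OSSData (m r nw nc : ℕ) where
  U : Set (Vec m)
  Z : Set (Vec r)
  W : Set (Vec nw)
  f₀ : Vec m → ℝ
  g₀ : Vec r → ℝ
  Hz : Matrix (Fin nc) (Fin r) ℝ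
  Hu : Matrix (Fin nc) (Fin m) ℝ
  Hw : Matrix (Fin nc) (Fin nw) ℝ

/-- The two affine constraints `z = G_u u + G_w w` and `0 = H_z z + H_u u + H_w w`. -/
def SteadyStateConstraints {n m r nw nc : ℕ} (S : Plant n m r nw) (O : OSSData m r nw nc)
    (w : Vec nw) (z : Vec r) (u : Vec m) : Prop :=
  z = S.Gu *ₑ u + S.Gw *ₑ w ∧ 0 = O.Hz *ₑ z + O.Hu *ₑ u + O.Hw *ₑ w

/-- `(z, u)` is feasible for the steady-state optimization problem with disturbance `w`. -/
def IsFeasible {n m r nw nc : ℕ} (S : Plant n m r nw) (O : OSSData m r nw nc)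
    (w : Vec nw) (z : Vec r) (u : Vec m) : Prop :=
  z ∈ O.Z ∧ u ∈ O.U ∧ SteadyStateConstraints S O w z u

/-- `(z, u)` is an optimal point: it minimizes `f₀ u + g₀ z` among the feasible points. -/
def IsOptimal {n m r nw nc : ℕ} (S : Plant n m r nw) (O : OSSData m r nw nc)
    (w : Vec nw) (z : Vec r) (u : Vec m) : Prop :=
  IsFeasible S O w z u ∧
    ∀ z' u', IsFeasible S O w z' u' → O.f₀ u + O.g₀ z ≤ O.f₀ u' + O.g₀ z'

/-- Standing assumptions on the problem data. The gradients of `f₀`, `g₀` are available only on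
the interiors of the domains, so the optimal solution is taken in the interiors (which contains
strict feasibility). Closedness of `U` and `Z` is not required, so that domains of barrier
functions are covered too. -/
structure StandingAssumptions {n m r nw nc : ℕ} (S : Plant n m r nw)
    (O : OSSData m r nw nc) : Prop where
  convexOn_f₀ : ConvexOn ℝ O.U O.f₀
  convexOn_g₀ : ConvexOn ℝ O.Z O.g₀
  contDiffOn_f₀ : ContDiffOn ℝ 1 O.f₀ (interior O.U)
  contDiffOn_g₀ : ContDiffOn ℝ 1 O.g₀ (interior O.Z)
  locallyLipschitz_grad_f₀ : LocallyLipschitzOn (interior O.U) (gradient O.f₀)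
  locallyLipschitz_grad_g₀ : LocallyLipschitzOn (interior O.Z) (gradient O.g₀)
  convex_W : Convex ℝ O.W
  isCompact_W : IsCompact O.W
  exists_optimal : ∀ w ∈ O.W, ∃ z ∈ interior O.Z, ∃ u ∈ interior O.U, IsOptimal S O w z u

/-- The matrix `N = H_z G_u + H_u`. -/
noncomputable def constraintGain {n m r nw nc : ℕ} (S : Plant n m r nw) (O : OSSData m r nw nc) :
    Matrix (Fin nc) (Fin m) ℝ :=
  O.Hz * S.Gu + O.Hu

/-- `range [T_z; T_u] = null [I, -G_u; H_z, H_u]`. -/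
def SpansFeasibleSubspace {n m r nw nc q : ℕ} (S : Plant n m r nw) (O : OSSData m r nw nc)
    (Tz : Matrix (Fin r) (Fin q) ℝ) (Tu : Matrix (Fin m) (Fin q) ℝ) : Prop :=
  LinearMap.range (Matrix.fromRows Tz Tu).mulVecLin =
    LinearMap.ker (Matrix.fromBlocks 1 (-S.Gu) O.Hz O.Hu).mulVecLin

/-- The matrix `Π_c = I - K₂ (N K₂)⁻¹ N`. -/
noncomputable def projC {m nc : ℕ} (N : Matrix (Fin nc) (Fin m) ℝ)
    (K₂ : Matrix (Fin m) (Fin nc) ℝ) : Matrix (Fin m) (Fin m) ℝ :=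
  1 - K₂ * (N * K₂)⁻¹ * N

/-! ### The closed loop with the two-loop integral controller

The state is `(x, η₁, η₂)`. -/

section ClosedLoop

variable {n m r nw nc q : ℕ} (S : Plant n m r nw) (O : OSSData m r nw nc)
  (Tz : Matrix (Fin r) (Fin q) ℝ) (Tu : Matrix (Fin m) (Fin q) ℝ)
  (K₁ : Matrix (Fin m) (Fin q) ℝ) (K₂ : Matrix (Fin m) (Fin nc) ℝ) (τ₁ τ₂ : ℝ) (w : Vec nw)

/-- The control input `u = K₁ η₁ + K₂ η₂`. -/
noncomputable def clInput (s : Vec n × Vec q × Vec nc) : Vec m :=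
  K₁ *ₑ s.2.1 + K₂ *ₑ s.2.2

/-- The plant output `z = C x + D u + D_w w`. -/
noncomputable def clOutput (s : Vec n × Vec q × Vec nc) : Vec r :=
  S.C *ₑ s.1 + S.D *ₑ clInput K₁ K₂ s + S.Dw *ₑ w

/-- The states at which the closed-loop vector field is defined: those where the gradients of
`f₀` and `g₀` exist. -/
def clDomain : Set (Vec n × Vec q × Vec nc) :=
  {s | clInput K₁ K₂ s ∈ interior O.U ∧ clOutput S K₁ K₂ w s ∈ interior O.Z}

/-- The closed-loop vector field:
`ẋ = A x + B u + B_w w`, `τ₁ η̇₁ = -(T_uᵀ ∇f₀(u) + T_zᵀ ∇g₀(z))`,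
`τ₂ η̇₂ = -(H_z z + H_u u + H_w w)`. -/
noncomputable def clField (s : Vec n × Vec q × Vec nc) : Vec n × Vec q × Vec nc :=
  (S.A *ₑ s.1 + S.B *ₑ clInput K₁ K₂ s + S.Bw *ₑ w,
   -(τ₁⁻¹ • (Tuᵀ *ₑ gradient O.f₀ (clInput K₁ K₂ s) +
      Tzᵀ *ₑ gradient O.g₀ (clOutput S K₁ K₂ w s))),
   -(τ₂⁻¹ • (O.Hz *ₑ clOutput S K₁ K₂ w s + O.Hu *ₑ clInput K₁ K₂ s + O.Hw *ₑ w)))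

/-- The two-loop controller with these gains and time constants solves the optimal steady-state
control problem: for each disturbance in `W`, the closed loop has exactly one equilibrium point,
this point is locally exponentially stable, and the equilibrium values of output and input are an
optimal point of the steady-state optimization problem. -/
def SolvesOSS : Prop :=
  ∀ w ∈ O.W, ∃ p : Vec n × Vec q × Vec nc,
    IsEquilibrium (clField S O Tz Tu K₁ K₂ τ₁ τ₂ w) (clDomain S O K₁ K₂ w) p ∧
    (∀ p', IsEquilibrium (clField S O Tz Tu K₁ K₂ τ₁ τ₂ w) (clDomain S O K₁ K₂ w) p' → p' = p) ∧
    IsLocallyExpStable (clField S O Tz Tu K₁ K₂ τ₁ τ₂ w) (clDomain S O K₁ K₂ w) p ∧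
    IsOptimal S O w (clOutput S K₁ K₂ w p) (clInput K₁ K₂ p)

end ClosedLoop

/-!
The points satisfying the affine constraints form a translate of the range of `T`, so `(∗)` is the
minimization of a strongly convex function of a parameter `ξ`, and an interior feasible point is
optimal exactly when `T_uᵀ ∇f₀(u) + T_zᵀ ∇g₀(z) = 0`. Since `Π_c K₁ = T_u P`, the map
`(η₁, η₂) ↦ K₁ η₁ + K₂ η₂` is a bijection onto the inputs; hence equilibria of the closed loop
correspond to critical points of the reduced objective, that is, to the unique optimum.

For stability, the deviations from the equilibrium are written as a slow variable (the parameter `ξ`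
of the feasible part of the input), an intermediate one (the deviation of `η₂` from the value that
restores the engineering constraint) and a fast one (the distance of the plant state from its steady
state for the current input). The Lyapunov function is the sum of the gap of the reduced objective
and of quadratic forms solving the Lyapunov equations of `-N K₂` and `A`. Each of the three parts
decays at its own rate, and the cross terms are absorbed once `τ₂` and `τ₁ / τ₂` are large. How
large depends on `w` only through a Lipschitz constant of `∇f₀` and `∇g₀` near the optimum,
which can be chosen uniformly because the optimum depends continuously on `w` and the set of
disturbances is compact. The decay rate and the basin may still depend on `w`.
-/

/-! ### Lyapunov functions and exponential stability -/

section ODE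

open Set Filter Topology Metric NNReal

variable {E : Type*} [NormedAddCommGroup E] [NormedSpace ℝ E]

theorem exists_hasDerivWithinAt_Icc_of_lipschitz_of_bounded [CompleteSpace E] {G : E → E}
    {K M : ℝ≥0} (hG : LipschitzWith K G) (hM : ∀ x, ‖G x‖ ≤ M) (x₀ : E) {T : ℝ} (hT : 0 ≤ T) :
    ∃ α : ℝ → E, α 0 = x₀ ∧ ∀ t ∈ Icc 0 T, HasDerivWithinAt α (G (α t)) (Icc 0 T) t := by
  have hPicard : IsPicardLindelof (fun _ => G) (⟨0, le_rfl, hT⟩ : Icc 0 T) x₀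
      (M * T.toNNReal) 0 M K :=
    .of_time_independent (fun x _ => hM x) hG.lipschitzOnWith (by simp [hT])
  exact hPicard.exists_eq_forall_mem_Icc_hasDerivWithinAt₀

theorem hasDerivWithinAt_Ici_of_Icc {α : ℝ → E} {v : E} {T t : ℝ} (ht : t ∈ Ico 0 T)
    (h : HasDerivWithinAt α v (Icc 0 T) t) : HasDerivWithinAt α v (Ici 0) t := by
  refine h.mono_of_mem_nhdsWithin ?_
  rw [← Ici_inter_Iic]
  exact inter_mem self_mem_nhdsWithin (mem_nhdsWithin_of_mem_nhds (Iic_mem_nhds ht.2))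

theorem exists_isSolution_of_lipschitz_of_bounded [CompleteSpace E] {G : E → E} {K M : ℝ≥0}
    (hG : LipschitzWith K G) (hM : ∀ x, ‖G x‖ ≤ M) (x₀ : E) :
    ∃ φ, IsSolution G univ φ ∧ φ 0 = x₀ := by
  choose α hα₀ hα using fun k : ℕ =>
    exists_hasDerivWithinAt_Icc_of_lipschitz_of_bounded hG hM x₀ k.cast_nonneg
  have hIci {k : ℕ} {t : ℝ} (ht : t ∈ Ico (0 : ℝ) k) :
      HasDerivWithinAt (α k) (G (α k t)) (Ici 0) t :=
    hasDerivWithinAt_Ici_of_Icc ht (hα k t ⟨ht.1, ht.2.le⟩)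
  have hagree {j k : ℕ} (hjk : j ≤ k) : EqOn (α j) (α k) (Icc (0 : ℝ) j) := by
    have hjk' : (j : ℝ) ≤ k := by exact_mod_cast hjk
    have hsub : Icc (0 : ℝ) j ⊆ Icc (0 : ℝ) k := Icc_subset_Icc_right hjk'
    exact ODE_solution_unique (v := fun _ => G) (K := K) (fun _ => hG)
      (fun t ht => (hα j t ht).continuousWithinAt)
      (fun t ht => (hIci ht).mono (Ici_subset_Ici.2 ht.1))
      (fun t ht => ((hα k t (hsub ht)).continuousWithinAt).mono hsub)
      (fun t ht => (hIci ⟨ht.1, ht.2.trans_le hjk'⟩).mono (Ici_subset_Ici.2 ht.1))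
      (by rw [hα₀, hα₀])
  have hlt (t : ℝ) : t < (⌈t⌉₊ + 1 : ℕ) := by
    push_cast
    linarith [Nat.le_ceil t]
  have hglue (k : ℕ) (t : ℝ) (ht : t ∈ Icc (0 : ℝ) k) : α (⌈t⌉₊ + 1) t = α k t := by
    rcases le_total (⌈t⌉₊ + 1) k with h | h
    · exact hagree h ⟨ht.1, (hlt t).le⟩
    · exact (hagree h ht).symm
  refine ⟨fun t => α (⌈t⌉₊ + 1) t, fun t ht => ⟨mem_univ _, ?_⟩, hα₀ _⟩
  refine (hIci ⟨ht, hlt t⟩).congr_of_eventuallyEq ?_ rfl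
  filter_upwards [self_mem_nhdsWithin, mem_nhdsWithin_of_mem_nhds (Iio_mem_nhds (hlt t))]
    with s hs hst
  exact hglue _ s ⟨hs, hst.le⟩

theorem lipschitzWith_radialScaling {R : ℝ} (hR : 0 < R) :
    LipschitzWith 2 fun x : E => (R / max R ‖x‖) • x := by
  have hmax (x : E) : 0 < max R ‖x‖ := lt_max_of_lt_left hR
  refine LipschitzWith.of_dist_le_mul fun x y => ?_
  set a := max R ‖x‖
  set b := max R ‖y‖
  have ha : |R / a| ≤ 1 := by
    rw [abs_of_pos (div_pos hR (hmax x))]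
    exact div_le_one_of_le₀ (le_max_left _ _) (hmax x).le
  have hb : ‖y‖ / b ≤ 1 := div_le_one_of_le₀ (le_max_right _ _) (hmax y).le
  have hab : |b - a| ≤ ‖x - y‖ :=
    calc |b - a| ≤ |‖y‖ - ‖x‖| := by
          simpa only [a, b, max_comm R] using abs_max_sub_max_le_abs ‖y‖ ‖x‖ R
      _ ≤ ‖x - y‖ := norm_sub_rev x y ▸ abs_norm_sub_norm_le y x
  have hdiff : |R / a - R / b| * ‖y‖ ≤ ‖x - y‖ :=
    calc |R / a - R / b| * ‖y‖ = |R / a| * |b - a| * (‖y‖ / b) := by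
          have ha₀ : a ≠ 0 := (hmax x).ne'
          have hb₀ : b ≠ 0 := (hmax y).ne'
          rw [show R / a - R / b = R / a * (b - a) / b by field_simp, abs_div, abs_mul,
            abs_of_pos (hmax y)]
          ring
      _ ≤ 1 * ‖x - y‖ * 1 := by gcongr
      _ = ‖x - y‖ := by ring
  calc dist ((R / a) • x) ((R / b) • y)
      = ‖(R / a) • (x - y) + (R / a - R / b) • y‖ := by
        rw [dist_eq_norm]
        congr 1
        module
    _ ≤ |R / a| * ‖x - y‖ + |R / a - R / b| * ‖y‖ := by
        simpa only [norm_smul, Real.norm_eq_abs] using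
          norm_add_le ((R / a) • (x - y)) ((R / a - R / b) • y)
    _ ≤ 1 * ‖x - y‖ + ‖x - y‖ := by gcongr
    _ = (2 : ℝ≥0) * dist x y := by rw [dist_eq_norm, NNReal.coe_ofNat]; ring

theorem exists_lipschitzWith_retraction_closedBall (p : E) {R : ℝ} (hR : 0 < R) :
    ∃ ρ : E → E, LipschitzWith 2 ρ ∧ (∀ x, ρ x ∈ closedBall p R) ∧
      EqOn ρ id (closedBall p R) := by
  have hmax (x : E) : 0 < max R ‖x - p‖ := lt_max_of_lt_left hR
  refine ⟨fun x => p + (R / max R ‖x - p‖) • (x - p), ?_, fun x => ?_, fun x hx => ?_⟩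
  · refine LipschitzWith.of_dist_le_mul fun x y => ?_
    rw [dist_add_left, ← dist_sub_right x y p]
    exact (lipschitzWith_radialScaling hR).dist_le_mul (x - p) (y - p)
  · rw [mem_closedBall_iff_norm, add_sub_cancel_left, norm_smul, Real.norm_eq_abs,
      abs_of_pos (div_pos hR (hmax x)), div_mul_eq_mul_div, div_le_iff₀ (hmax x)]
    gcongr
    exact le_max_right _ _
  · beta_reduce
    rw [max_eq_left (mem_closedBall_iff_norm.1 hx), div_self hR.ne', one_smul,
      add_sub_cancel, id]

theorem exists_lipschitz_bounded_eqOn_closedBall {F : E → E} {p : E} {R : ℝ} (hR : 0 < R)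
    {K : ℝ≥0} (hF : LipschitzOnWith K F (closedBall p R)) :
    ∃ (G : E → E) (K' M : ℝ≥0), LipschitzWith K' G ∧ (∀ x, ‖G x‖ ≤ M) ∧
      EqOn G F (closedBall p R) := by
  obtain ⟨ρ, hρ, hρmem, hρid⟩ := exists_lipschitzWith_retraction_closedBall p hR
  refine ⟨F ∘ ρ, K * 2, ‖F p‖₊ + K * R.toNNReal, ?_, fun x => ?_, fun x hx => ?_⟩
  · rw [← lipschitzOnWith_univ] at hρ ⊢
    exact hF.comp hρ fun x _ => hρmem x
  · have hdist := hF.dist_le_mul _ (hρmem x) p (mem_closedBall_self hR.le)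
    rw [dist_eq_norm] at hdist
    rw [NNReal.coe_add, NNReal.coe_mul, coe_nnnorm, Real.coe_toNNReal _ hR.le]
    calc ‖F (ρ x)‖ ≤ ‖F p‖ + ‖F (ρ x) - F p‖ := norm_le_insert' _ _
      _ ≤ ‖F p‖ + K * dist (ρ x) p := by gcongr
      _ ≤ ‖F p‖ + K * R := by gcongr; exact hρmem x
  · rw [Function.comp_apply, hρid hx, id]

theorem forall_mem_of_forall_Ico_imp_mem {X : Type*} [TopologicalSpace X] {φ : ℝ → X} {U : Set X}
    (hφ : ContinuousOn φ (Ici 0)) (hU : IsOpen U)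
    (hstep : ∀ T, 0 ≤ T → (∀ t ∈ Ico 0 T, φ t ∈ U) → φ T ∈ U) {t : ℝ} (ht : 0 ≤ t) :
    φ t ∈ U := by
  by_contra hcon
  let exits : Set ℝ := Ici 0 ∩ φ ⁻¹' Uᶜ
  have hclosed : IsClosed exits := hφ.preimage_isClosed_of_isClosed isClosed_Ici hU.isClosed_compl
  have hbdd : BddBelow exits := ⟨0, fun t ht => ht.1⟩
  have hfirst : sInf exits ∈ exits := hclosed.csInf_mem ⟨t, ht, hcon⟩ hbdd
  refine hfirst.2 (hstep _ hfirst.1 fun s hs => ?_)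
  by_contra hsU
  exact (csInf_le hbdd ⟨hs.1, hsU⟩).not_gt hs.2

/-- `V`, with derivative `V'`, is a quadratic Lyapunov function on the set `s` for the point `p`
and the differential equation `ẋ = F x`: it lies between `c₁ ‖x - p‖²` and `c₂ ‖x - p‖²` and
decreases along `F` at least at the rate `c₃ ‖x - p‖²`. -/
structure IsQuadraticLyapunovOn (F : E → E) (s : Set E) (p : E) (V : E → ℝ) (V' : E → E →L[ℝ] ℝ)
    (c₁ c₂ c₃ : ℝ) : Prop where
  lower_pos : 0 < c₁
  upper_pos : 0 < c₂
  rate_pos : 0 < c₃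
  hasFDerivAt : ∀ x ∈ s, HasFDerivAt V (V' x) x
  lower : ∀ x ∈ s, c₁ * ‖x - p‖ ^ 2 ≤ V x
  upper : ∀ x ∈ s, V x ≤ c₂ * ‖x - p‖ ^ 2
  decrease : ∀ x ∈ s, V' x (F x) ≤ -c₃ * ‖x - p‖ ^ 2

namespace IsQuadraticLyapunovOn

variable {F : E → E} {s : Set E} {p : E} {R : ℝ} {V : E → ℝ} {V' : E → E →L[ℝ] ℝ}
  {c₁ c₂ c₃ T : ℝ} {φ : ℝ → E}

theorem le_exp_mul (hV : IsQuadraticLyapunovOn F s p V V' c₁ c₂ c₃) (hT : 0 ≤ T)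
    (hmem : ∀ t ∈ Icc 0 T, φ t ∈ s)
    (hφ : ∀ t ∈ Icc 0 T, HasDerivWithinAt φ (F (φ t)) (Ici 0) t) :
    V (φ T) ≤ V (φ 0) * Real.exp (-(c₃ / c₂) * T) := by
  have hderiv (t : ℝ) (ht : t ∈ Icc 0 T) :
      HasDerivWithinAt (V ∘ φ) (V' (φ t) (F (φ t))) (Ici 0) t :=
    (hV.hasFDerivAt _ (hmem t ht)).comp_hasDerivWithinAt t (hφ t ht)
  have hrate (t : ℝ) (ht : t ∈ Icc 0 T) : V' (φ t) (F (φ t)) ≤ -(c₃ / c₂) * V (φ t) + 0 := by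
    have hup := mul_le_mul_of_nonneg_left (hV.upper _ (hmem t ht))
      (div_pos hV.rate_pos hV.upper_pos).le
    rw [← mul_assoc, div_mul_cancel₀ _ hV.upper_pos.ne'] at hup
    linarith [hV.decrease _ (hmem t ht)]
  have hgronwall := le_gronwallBound_of_liminf_deriv_right_le
    (fun t ht => (hderiv t ht).continuousWithinAt.mono Icc_subset_Ici_self)
    (fun t ht r hr => ((hderiv t ⟨ht.1, ht.2.le⟩).mono
      (Ici_subset_Ici.2 ht.1)).liminf_right_slope_le hr)
    le_rfl (fun t ht => hrate t ⟨ht.1, ht.2.le⟩) T ⟨hT, le_rfl⟩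
  rwa [gronwallBound_ε0, sub_zero] at hgronwall

theorem norm_sub_le_exp (hV : IsQuadraticLyapunovOn F s p V V' c₁ c₂ c₃) (hT : 0 ≤ T)
    (hmem : ∀ t ∈ Icc 0 T, φ t ∈ s)
    (hφ : ∀ t ∈ Icc 0 T, HasDerivWithinAt φ (F (φ t)) (Ici 0) t) :
    ‖φ T - p‖ ≤ √(c₂ / c₁) * Real.exp (-(c₃ / (2 * c₂)) * T) * ‖φ 0 - p‖ := by
  have hlow := hV.lower_pos
  have hup := hV.upper_pos
  have hexp : Real.exp (-(c₃ / (2 * c₂)) * T) ^ 2 = Real.exp (-(c₃ / c₂) * T) := by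
    rw [← Real.exp_nat_mul]
    congr 1
    push_cast
    field_simp
  refine le_of_sq_le_sq ?_ (by positivity)
  rw [mul_pow, mul_pow, Real.sq_sqrt (by positivity), hexp, div_mul_eq_mul_div,
    div_mul_eq_mul_div, le_div_iff₀' hlow]
  calc c₁ * ‖φ T - p‖ ^ 2 ≤ V (φ T) := hV.lower _ (hmem T ⟨hT, le_rfl⟩)
    _ ≤ V (φ 0) * Real.exp (-(c₃ / c₂) * T) := hV.le_exp_mul hT hmem hφ
    _ ≤ c₂ * ‖φ 0 - p‖ ^ 2 * Real.exp (-(c₃ / c₂) * T) := by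
        gcongr
        exact hV.upper _ (hmem 0 ⟨le_rfl, hT⟩)
    _ = c₂ * Real.exp (-(c₃ / c₂) * T) * ‖φ 0 - p‖ ^ 2 := by ring

theorem mem_ball (hV : IsQuadraticLyapunovOn F (closedBall p R) p V V' c₁ c₂ c₃)
    (hcont : ContinuousOn φ (Ici 0))
    (hφ : ∀ t, 0 ≤ t → φ t ∈ closedBall p R → HasDerivWithinAt φ (F (φ t)) (Ici 0) t)
    (h0 : ‖φ 0 - p‖ < R) (h0' : √(c₂ / c₁) * ‖φ 0 - p‖ < R) (hT : 0 ≤ T) :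
    φ T ∈ ball p R := by
  refine forall_mem_of_forall_Ico_imp_mem hcont isOpen_ball (fun T hT hmem => ?_) hT
  rcases hT.eq_or_lt with rfl | hTpos
  · exact mem_ball_iff_norm.2 h0
  have hclosed (t : ℝ) (ht : t ∈ Icc 0 T) : φ t ∈ closedBall p R := by
    have hcont' : ContinuousOn φ (closure (Ico 0 T)) :=
      hcont.mono (closure_Ico hTpos.ne ▸ Icc_subset_Ici_self)
    have himage : φ '' Ico 0 T ⊆ ball p R := image_subset_iff.2 hmem
    exact closure_ball_subset_closedBall
      (hcont'.image_closure.trans (closure_mono himage) ⟨t, closure_Ico hTpos.ne ▸ ht, rfl⟩)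
  refine mem_ball_iff_norm.2 (lt_of_le_of_lt ?_ h0')
  refine (hV.norm_sub_le_exp hT hclosed fun t ht => hφ t ht.1 (hclosed t ht)).trans ?_
  gcongr
  refine mul_le_of_le_one_right (Real.sqrt_nonneg _) (Real.exp_le_one_iff.2 ?_)
  rw [neg_mul, neg_nonpos]
  exact mul_nonneg (div_pos hV.rate_pos (mul_pos two_pos hV.upper_pos)).le hT

theorem isLocallyExpStable [CompleteSpace E] {Ω : Set E} (hR : 0 < R) (hΩ : closedBall p R ⊆ Ω)
    {K : ℝ≥0} (hF : LipschitzOnWith K F (closedBall p R))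
    (hV : IsQuadraticLyapunovOn F (closedBall p R) p V V' c₁ c₂ c₃) :
    IsLocallyExpStable F Ω p := by
  have hlow := hV.lower_pos
  have hup := hV.upper_pos
  have hrate := hV.rate_pos
  refine ⟨R / (√(c₂ / c₁) + 1), by positivity, √(c₂ / c₁), by positivity, c₃ / (2 * c₂),
    by positivity, fun x₀ hx₀ => ?_⟩
  rw [lt_div_iff₀ (by positivity), mul_add, mul_one, mul_comm] at hx₀
  have h0 : ‖x₀ - p‖ < R :=
    (le_add_of_nonneg_left (by positivity)).trans_lt hx₀
  have h0' : √(c₂ / c₁) * ‖x₀ - p‖ < R := (le_add_of_nonneg_right (norm_nonneg _)).trans_lt hx₀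
  constructor
  · obtain ⟨G, K', M, hG, hM, hGF⟩ := exists_lipschitz_bounded_eqOn_closedBall hR hF
    obtain ⟨φ, hφ, rfl⟩ := exists_isSolution_of_lipschitz_of_bounded hG hM x₀
    have hmem (t : ℝ) (ht : 0 ≤ t) : φ t ∈ closedBall p R :=
      ball_subset_closedBall (hV.mem_ball (fun t ht => (hφ t ht).2.continuousWithinAt)
        (fun t ht hφt => hGF hφt ▸ (hφ t ht).2) h0 h0' ht)
    exact ⟨φ, fun t ht => ⟨hΩ (hmem t ht), hGF (hmem t ht) ▸ (hφ t ht).2⟩, rfl⟩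
  · rintro φ hφ rfl t ht
    have hmem (s : ℝ) (hs : 0 ≤ s) : φ s ∈ closedBall p R :=
      ball_subset_closedBall (hV.mem_ball (fun t ht => (hφ t ht).2.continuousWithinAt)
        (fun t ht _ => (hφ t ht).2) h0 h0' hs)
    exact hV.norm_sub_le_exp ht (fun s hs => hmem s hs.1) fun s hs => (hφ s hs.1).2

end IsQuadraticLyapunovOn

end ODE

/-! ### Lyapunov equations of Hurwitz matrices -/

section MatrixAction

variable {a b c : ℕ}

theorem matAct_mul (M : Matrix (Fin a) (Fin b) ℝ) (N : Matrix (Fin b) (Fin c) ℝ) (v : Vec c) :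
    (M * N) *ₑ v = M *ₑ (N *ₑ v) := by
  simp [matAct, Matrix.toLpLin_apply, Matrix.mulVec_mulVec]

theorem matAct_add_matrix (M N : Matrix (Fin a) (Fin b) ℝ) (v : Vec b) :
    (M + N) *ₑ v = M *ₑ v + N *ₑ v := by
  simp [matAct]

theorem matAct_sub_matrix (M N : Matrix (Fin a) (Fin b) ℝ) (v : Vec b) :
    (M - N) *ₑ v = M *ₑ v - N *ₑ v := by
  simp [matAct]

theorem matAct_neg_matrix (M : Matrix (Fin a) (Fin b) ℝ) (v : Vec b) :
    (-M) *ₑ v = -(M *ₑ v) := by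
  simp [matAct]

theorem matAct_one (v : Vec a) : (1 : Matrix (Fin a) (Fin a) ℝ) *ₑ v = v := by
  simp [matAct]

theorem matAct_add (M : Matrix (Fin a) (Fin b) ℝ) (v v' : Vec b) :
    M *ₑ (v + v') = M *ₑ v + M *ₑ v' := map_add (Matrix.toEuclideanLin M) v v'

theorem matAct_sub (M : Matrix (Fin a) (Fin b) ℝ) (v v' : Vec b) :
    M *ₑ (v - v') = M *ₑ v - M *ₑ v' := map_sub (Matrix.toEuclideanLin M) v v'

theorem matAct_neg (M : Matrix (Fin a) (Fin b) ℝ) (v : Vec b) :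
    M *ₑ (-v) = -(M *ₑ v) := map_neg (Matrix.toEuclideanLin M) v

theorem matAct_zero (M : Matrix (Fin a) (Fin b) ℝ) : M *ₑ (0 : Vec b) = 0 :=
  map_zero (Matrix.toEuclideanLin M)

theorem eq_of_forall_matAct_eq {M N : Matrix (Fin a) (Fin b) ℝ} (h : ∀ v, M *ₑ v = N *ₑ v) :
    M = N :=
  (Matrix.toEuclideanLin (𝕜 := ℝ)).injective (LinearMap.ext h)

theorem inner_transpose_matAct (M : Matrix (Fin a) (Fin b) ℝ) (v : Vec a) (x : Vec b) :
    inner ℝ (Mᵀ *ₑ v) x = inner ℝ v (M *ₑ x) := by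
  simp [matAct, Matrix.toLpLin_apply, EuclideanSpace.inner_eq_star_dotProduct,
    Matrix.dotProduct_mulVec, Matrix.mulVec_transpose, dotProduct_comm]

/-- The matrix action as a continuous linear map, which carries an operator norm. -/
noncomputable def matCLM (M : Matrix (Fin a) (Fin b) ℝ) : Vec b →L[ℝ] Vec a :=
  LinearMap.toContinuousLinearMap (Matrix.toEuclideanLin M)

@[simp] theorem matCLM_apply (M : Matrix (Fin a) (Fin b) ℝ) (v : Vec b) : matCLM M v = M *ₑ v :=
  rfl

theorem matCLM_neg (M : Matrix (Fin a) (Fin b) ℝ) : matCLM (-M) = -matCLM M :=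
  ContinuousLinearMap.ext fun v => matAct_neg_matrix M v

theorem norm_matAct_le (M : Matrix (Fin a) (Fin b) ℝ) (v : Vec b) : ‖M *ₑ v‖ ≤ ‖matCLM M‖ * ‖v‖ :=
  (matCLM M).le_opNorm v

theorem nonsing_inv_matAct {M : Matrix (Fin a) (Fin a) ℝ} (hM : IsUnit M) (v : Vec a) :
    M⁻¹ *ₑ (M *ₑ v) = v := by
  rw [← matAct_mul, Matrix.nonsing_inv_mul _ ((Matrix.isUnit_iff_isUnit_det M).1 hM), matAct_one]

theorem matAct_nonsing_inv {M : Matrix (Fin a) (Fin a) ℝ} (hM : IsUnit M) (v : Vec a) :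
    M *ₑ (M⁻¹ *ₑ v) = v := by
  rw [← matAct_mul, Matrix.mul_nonsing_inv _ ((Matrix.isUnit_iff_isUnit_det M).1 hM), matAct_one]

end MatrixAction

section Lyapunov

open Filter Topology NNReal ENNReal

variable {H : Type*} [NormedAddCommGroup H] [InnerProductSpace ℝ H]

/-- `Q` solves the Lyapunov inequality for `ẋ = M x`: the quadratic form `⟪Q x, x⟫` is coercive
and decreases along solutions at least at the rate `‖x‖²`. -/
structure IsLyapunovOperator (M Q : H →L[ℝ] H) : Prop where
  symm : ∀ v v', inner ℝ (Q v) v' = inner ℝ v (Q v')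
  coercive : ∃ c > 0, ∀ v, c * ‖v‖ ^ 2 ≤ inner ℝ (Q v) v
  decrease : ∀ v, 2 * inner ℝ (Q v) (M v) ≤ -‖v‖ ^ 2

open ContinuousLinearMap in
theorem exists_stein_operator [CompleteSpace H] (T : H →L[ℝ] H)
    (hT : Summable fun j : ℕ => ‖T ^ j‖ ^ 2) :
    ∃ Q : H →L[ℝ] H, (∀ v v', inner ℝ (Q v) v' = inner ℝ v (Q v')) ∧
      (∀ v, ‖v‖ ^ 2 ≤ inner ℝ (Q v) v) ∧
      ∀ v, inner ℝ (Q (T v)) (T v) = inner ℝ (Q v) v - ‖v‖ ^ 2 := by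
  have hsummable : Summable fun j : ℕ => adjoint (T ^ j) ∘L (T ^ j) := by
    refine Summable.of_norm_bounded hT fun j => ?_
    refine (opNorm_comp_le _ _).trans ?_
    rw [LinearIsometryEquiv.norm_map, sq]
  have hsum (v v' : H) : HasSum (fun j => inner ℝ ((T ^ j) v) ((T ^ j) v'))
      (inner ℝ ((∑' j : ℕ, adjoint (T ^ j) ∘L (T ^ j)) v) v') := by
    have happly := (hsummable.hasSum.mapL (ContinuousLinearMap.apply ℝ H v)).mapL (innerSL ℝ v')
    simpa only [apply_apply, innerSL_apply_apply, ContinuousLinearMap.comp_apply,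
      adjoint_inner_right, real_inner_comm] using happly
  refine ⟨∑' j : ℕ, adjoint (T ^ j) ∘L (T ^ j), fun v v' => ?_, fun v => ?_, fun v => ?_⟩
  · rw [real_inner_comm _ v]
    refine (hsum v v').unique ?_
    simpa only [real_inner_comm] using hsum v' v
  · simpa using le_hasSum (hsum v v) 0 fun j _ => real_inner_self_nonneg
  · refine (hsum (T v) (T v)).unique ?_
    simpa [pow_succ] using (hasSum_nat_add_iff' 1).2 (hsum v v)

-- The Stein operator of the explicit Euler step `1 + ε M` satisfies
-- `2 ε ⟪Q v, M v⟫ + ε² ⟪Q M v, M v⟫ = -‖v‖²`, whose second term is nonnegative.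
theorem exists_isLyapunovOperator_of_summable_euler_pow [CompleteSpace H] (M : H →L[ℝ] H) {ε : ℝ}
    (hε : 0 < ε) (hsum : Summable fun j : ℕ => ‖(1 + ε • M) ^ j‖ ^ 2) :
    ∃ Q : H →L[ℝ] H, IsLyapunovOperator M Q := by
  obtain ⟨Q, hsymm, hcoer, hstein⟩ := exists_stein_operator _ hsum
  refine ⟨ε • Q, fun v v' => ?_, ⟨ε, hε, fun v => ?_⟩, fun v => ?_⟩
  · simp only [_root_.smul_apply, real_inner_smul_left, real_inner_smul_right, hsymm]
  · rw [_root_.smul_apply, real_inner_smul_left]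
    exact mul_le_mul_of_nonneg_left (hcoer v) hε.le
  · have hstep := hstein v
    have hcross : inner ℝ (Q (M v)) v = inner ℝ (Q v) (M v) := by rw [hsymm, real_inner_comm]
    have hnonneg : 0 ≤ inner ℝ (Q (M v)) (M v) := (sq_nonneg _).trans (hcoer (M v))
    simp only [_root_.add_apply, _root_.smul_apply, one_apply_eq_self, map_add, map_smul,
      inner_add_left, inner_add_right, real_inner_smul_left, real_inner_smul_right,
      hcross] at hstep ⊢
    linarith [mul_nonneg hε.le (mul_nonneg hε.le hnonneg)]

theorem exists_eventually_norm_pow_le_of_spectrum {A : Type*} [NormedRing A] [NormedAlgebra ℂ A]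
    [CompleteSpace A] {a : A} (ha : ∀ s ∈ spectrum ℂ a, ‖s‖ < 1) :
    ∃ r : ℝ, 0 ≤ r ∧ r < 1 ∧ ∀ᶠ n : ℕ in atTop, ‖a ^ n‖ ≤ r ^ n := by
  have hradius : spectralRadius ℂ a < 1 := by
    rcases (spectrum ℂ a).eq_empty_or_nonempty with h | h
    · simp [spectralRadius, h]
    · exact_mod_cast spectrum.spectralRadius_lt_of_forall_lt_of_nonempty h (r := 1)
        fun k hk => by exact_mod_cast ha k hk
  obtain ⟨r, hr, hr1⟩ := ENNReal.lt_iff_exists_nnreal_btwn.1 hradius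
  refine ⟨r, r.2, by exact_mod_cast hr1, ?_⟩
  filter_upwards [(spectrum.pow_nnnorm_pow_one_div_tendsto_nhds_spectralRadius a).eventually
    (gt_mem_nhds hr), eventually_gt_atTop 0] with n hn hn0
  have hpow : ((‖a ^ n‖₊ : ℝ≥0∞) ^ (1 / n : ℝ)) ^ n ≤ (r : ℝ≥0∞) ^ n := by gcongr
  rw [one_div, ENNReal.rpow_inv_natCast_pow hn0.ne'] at hpow
  exact_mod_cast hpow

variable {k : ℕ} {M : Matrix (Fin k) (Fin k) ℝ}

theorem matCLM_pow (M : Matrix (Fin k) (Fin k) ℝ) (j : ℕ) : matCLM M ^ j = matCLM (M ^ j) :=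
  (map_pow (Matrix.toEuclideanCLM (n := Fin k) (𝕜 := ℝ)) M j).symm

section

attribute [local instance] Matrix.linftyOpNormedRing Matrix.linftyOpNormedAlgebra

theorem exists_norm_matCLM_le (k : ℕ) :
    ∃ C : ℝ≥0, ∀ X : Matrix (Fin k) (Fin k) ℝ, ‖matCLM X‖ ≤ C * ‖X‖ := by
  obtain ⟨C, _, hC⟩ := (LinearMap.toContinuousLinearMap
    (Matrix.toEuclideanCLM (n := Fin k) (𝕜 := ℝ)).toAlgEquiv.toLinearMap).isBoundedLinearMap.bound
  exact ⟨⟨C, by positivity⟩, hC⟩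

theorem summable_norm_matCLM_pow_sq {T : Matrix (Fin k) (Fin k) ℝ}
    (hT : ∀ s ∈ spectrum ℂ (T.map (algebraMap ℝ ℂ)), ‖s‖ < 1) :
    Summable fun j : ℕ => ‖matCLM T ^ j‖ ^ 2 := by
  obtain ⟨r, hr0, hr1, hr⟩ := exists_eventually_norm_pow_le_of_spectrum hT
  obtain ⟨C, hC⟩ := exists_norm_matCLM_le k
  have hmap (X : Matrix (Fin k) (Fin k) ℝ) : ‖X.map (algebraMap ℝ ℂ)‖ = ‖X‖ := by
    simp [Matrix.linfty_opNorm_def, Matrix.map_apply]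
  refine Summable.of_norm_bounded_eventually_nat (g := fun j => C ^ 2 * (r ^ 2) ^ j)
    ((summable_geometric_of_lt_one (sq_nonneg r)
      (pow_lt_one₀ hr0 hr1 two_ne_zero)).mul_left _) ?_
  filter_upwards [hr] with j hj
  rw [show T.map (algebraMap ℝ ℂ) ^ j = (T ^ j).map (algebraMap ℝ ℂ) from
    (map_pow (algebraMap ℝ ℂ).mapMatrix T j).symm, hmap] at hj
  rw [matCLM_pow, Real.norm_of_nonneg (sq_nonneg _), pow_right_comm, ← mul_pow]
  gcongr
  exact (hC _).trans (by gcongr)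

end

theorem eventually_norm_one_add_smul_lt_one {s : ℂ} (hs : s.re < 0) :
    ∀ᶠ ε : ℝ in 𝓝[>] 0, ‖1 + ε * s‖ < 1 := by
  have hlim : Tendsto (fun ε : ℝ => 2 * s.re + ε * Complex.normSq s) (𝓝[>] 0) (𝓝 (2 * s.re)) :=
    ((by fun_prop : Continuous fun ε : ℝ => 2 * s.re + ε * Complex.normSq s).tendsto' 0 _
      (by simp)).mono_left nhdsWithin_le_nhds
  filter_upwards [hlim.eventually_lt_const (by linarith : 2 * s.re < 0), self_mem_nhdsWithin]
    with ε hneg hε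
  have hsq : ‖1 + ε * s‖ ^ 2 = 1 + ε * (2 * s.re + ε * Complex.normSq s) := by
    rw [← Complex.normSq_eq_norm_sq, Complex.normSq_apply, Complex.normSq_apply]
    simp
    ring
  exact (sq_lt_one_iff₀ (norm_nonneg _)).1 (hsq ▸ by linarith [mul_neg_of_pos_of_neg hε hneg])

theorem mem_spectrum_of_mem_spectrum_one_add_smul {ε : ℝ} (hε : ε ≠ 0) {s : ℂ}
    (hs : s ∈ spectrum ℂ ((1 + ε • M).map (algebraMap ℝ ℂ))) :
    ∃ s' ∈ spectrum ℂ (M.map (algebraMap ℝ ℂ)), s = 1 + ε * s' := by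
  have haffine : (1 + ε • M).map (algebraMap ℝ ℂ) =
      algebraMap ℂ _ 1 + Units.mk0 (ε : ℂ) (by exact_mod_cast hε) • M.map (algebraMap ℝ ℂ) := by
    ext i j
    simp [Matrix.one_apply, Units.smul_def, apply_ite]
  rw [haffine, ← spectrum.singleton_add_eq, spectrum.unit_smul_eq_smul] at hs
  obtain ⟨_, rfl, _, ⟨s', hs', rfl⟩, rfl⟩ := hs
  exact ⟨s', hs', rfl⟩

namespace IsHurwitz

theorem isUnit (hM : IsHurwitz M) : IsUnit M := by
  have h0 : (0 : ℂ) ∉ spectrum ℂ (M.map (algebraMap ℝ ℂ)) := fun h => lt_irrefl _ (hM 0 h)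
  rw [spectrum.zero_notMem_iff, Matrix.isUnit_iff_isUnit_det, isUnit_iff_ne_zero] at h0
  rw [Matrix.isUnit_iff_isUnit_det, isUnit_iff_ne_zero]
  intro hdet
  apply h0
  have := RingHom.map_det (algebraMap ℝ ℂ) M
  rw [hdet, map_zero] at this
  exact this.symm

theorem exists_isLyapunovOperator (hM : IsHurwitz M) : ∃ Q, IsLyapunovOperator (matCLM M) Q := by
  have hdisc : ∀ᶠ ε : ℝ in 𝓝[>] 0,
      ∀ s ∈ spectrum ℂ (M.map (algebraMap ℝ ℂ)), ‖1 + ε * s‖ < 1 :=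
    (Matrix.finite_spectrum _).eventually_all.2 fun s hs =>
      eventually_norm_one_add_smul_lt_one (hM s hs)
  obtain ⟨ε, hε, hε0⟩ := (hdisc.and self_mem_nhdsWithin).exists
  have hspec : ∀ s ∈ spectrum ℂ ((1 + ε • M).map (algebraMap ℝ ℂ)), ‖s‖ < 1 := by
    intro s hs
    obtain ⟨s', hs', rfl⟩ := mem_spectrum_of_mem_spectrum_one_add_smul (ne_of_gt hε0) hs
    exact hε s' hs'
  have heuler : matCLM (1 + ε • M) = 1 + ε • matCLM M := by
    ext1 v
    simp [matCLM]
  exact exists_isLyapunovOperator_of_summable_euler_pow _ hε0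
    (heuler ▸ summable_norm_matCLM_pow_sq hspec)

end IsHurwitz

end Lyapunov

/-! ### Systems with three time scales -/

section QuadraticForms

variable {H X : Type*} [NormedAddCommGroup H] [InnerProductSpace ℝ H] [NormedAddCommGroup X]
  [NormedSpace ℝ X]

theorem hasFDerivAt_inner_self_apply {Q : H →L[ℝ] H}
    (hQ : ∀ v v', inner ℝ (Q v) v' = inner ℝ v (Q v')) (v : H) :
    HasFDerivAt (fun v => inner ℝ (Q v) v) ((2 : ℝ) • innerSL ℝ (Q v)) v := by
  refine (Q.hasFDerivAt.inner ℝ (hasFDerivAt_id v)).congr_fderiv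
    (ContinuousLinearMap.ext fun h => ?_)
  have hsymm : inner ℝ (Q h) v = inner ℝ (Q v) h := by rw [hQ, real_inner_comm]
  simp [hsymm, two_mul]

theorem inner_apply_comp_le (Q : H →L[ℝ] H) (T : X →L[ℝ] H) (x : X) :
    inner ℝ (Q (T x)) (T x) ≤ ‖Q‖ * ‖T‖ ^ 2 * ‖x‖ ^ 2 :=
  calc inner ℝ (Q (T x)) (T x) ≤ ‖Q (T x)‖ * ‖T x‖ := real_inner_le_norm _ _
    _ ≤ ‖Q‖ * ‖T x‖ * ‖T x‖ := by gcongr; exact Q.le_opNorm _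
    _ ≤ ‖Q‖ * (‖T‖ * ‖x‖) * (‖T‖ * ‖x‖) := by gcongr <;> exact T.le_opNorm _
    _ = ‖Q‖ * ‖T‖ ^ 2 * ‖x‖ ^ 2 := by ring

theorem mul_norm_le_norm_apply_of_coercive {P : H →L[ℝ] H} {μ : ℝ}
    (hP : ∀ v, μ * ‖v‖ ^ 2 ≤ inner ℝ v (P v)) (v : H) : μ * ‖v‖ ≤ ‖P v‖ := by
  rcases (norm_nonneg v).eq_or_lt with hv | hv
  · simp [← hv]
  · refine le_of_mul_le_mul_left ?_ hv
    calc ‖v‖ * (μ * ‖v‖) = μ * ‖v‖ ^ 2 := by ring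
      _ ≤ inner ℝ v (P v) := hP v
      _ ≤ ‖v‖ * ‖P v‖ := real_inner_le_norm _ _

theorem IsLyapunovOperator.two_mul_inner_smul_add_le {M Q : H →L[ℝ] H}
    (hQ : IsLyapunovOperator M Q) {e : ℝ} (he : 0 ≤ e) (v y : H) :
    2 * inner ℝ (Q v) (e • M v + y) ≤ -(e * ‖v‖ ^ 2) + 2 * ‖Q‖ * ‖v‖ * ‖y‖ :=
  calc 2 * inner ℝ (Q v) (e • M v + y)
      = e * (2 * inner ℝ (Q v) (M v)) + 2 * inner ℝ (Q v) y := by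
        rw [inner_add_right, real_inner_smul_right]
        ring
    _ ≤ e * -‖v‖ ^ 2 + 2 * (‖Q‖ * ‖v‖ * ‖y‖) := by
        gcongr
        · exact hQ.decrease v
        · exact (real_inner_le_norm _ _).trans (by gcongr; exact Q.le_opNorm v)
    _ = -(e * ‖v‖ ^ 2) + 2 * ‖Q‖ * ‖v‖ * ‖y‖ := by ring

/-- `Φ` has gradient `G` on `s`, and there it behaves quadratically near the critical point `0`:
`Φ - Φ 0` lies between `κ / 2 ‖ξ‖²` and `ℓ ‖ξ‖²`, and `‖G ξ‖ ≥ κ ‖ξ‖`. -/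
structure HasQuadraticGrowthOn (Φ : H → ℝ) (G : H → H) (s : Set H) (κ ℓ : ℝ) : Prop where
  lower_pos : 0 < κ
  upper_nonneg : 0 ≤ ℓ
  hasFDerivAt : ∀ ξ ∈ s, HasFDerivAt Φ (innerSL ℝ (G ξ)) ξ
  lower : ∀ ξ ∈ s, κ / 2 * ‖ξ‖ ^ 2 ≤ Φ ξ - Φ 0
  upper : ∀ ξ ∈ s, Φ ξ - Φ 0 ≤ ℓ * ‖ξ‖ ^ 2
  gradient : ∀ ξ ∈ s, κ * ‖ξ‖ ≤ ‖G ξ‖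

end QuadraticForms

section ThreeTimeScaleInequality

theorem two_mul_mul_le_mul_sq_add_sq_div {p : ℝ} (hp : 0 < p) (x y : ℝ) :
    2 * x * y ≤ p * x ^ 2 + y ^ 2 / p := by
  have hsq : (p * x - y) ^ 2 / p = p * x ^ 2 + y ^ 2 / p - 2 * x * y := by
    field_simp
    ring
  linarith [div_nonneg (sq_nonneg (p * x - y)) hp.le]

theorem exists_three_timeScale_coupling_le {p C : ℝ} (hp : 0 < p) (hC : 0 ≤ C) :
    ∃ τstar > (0 : ℝ), ∃ ρ > (0 : ℝ), ∀ e₁ e₂ : ℝ, 0 < e₁ → 0 < e₂ → e₂ * τstar < 1 →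
      ρ * e₁ < e₂ → ∀ g a b : ℝ,
      C * (e₁ * g * (a + b) + a * (e₂ * b + e₁ * (g + a + b)) +
        b * (e₁ * (g + a + b) + e₂ * (a + b))) ≤
      (p * e₁ * g ^ 2 + e₂ * a ^ 2 + b ^ 2) / 2 := by
  refine ⟨2 * (1 / 4 + 4 * C ^ 2 + C), by positivity, 4 * (4 * C ^ 2 / p + 2 * C) + 1,
    by positivity, fun e₁ e₂ he₁ he₂ hτ hρ g a b => ?_⟩
  have hga := two_mul_mul_le_mul_sq_add_sq_div (p := p / 4) (by positivity) g (C * a)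
  have hgb := two_mul_mul_le_mul_sq_add_sq_div (p := p / 4) (by positivity) g (C * b)
  have hab := two_mul_mul_le_mul_sq_add_sq_div (p := 1 / 4) (by positivity) a (C * b)
  have hslow : C * (2 * g * (a + b) + (a + b) ^ 2) ≤
      p * g ^ 2 / 2 + (4 * C ^ 2 / p + 2 * C) * (a ^ 2 + b ^ 2) := by
    have hsq : C * (a + b) ^ 2 ≤ C * (2 * (a ^ 2 + b ^ 2)) := by
      gcongr
      linarith [sq_nonneg (a - b)]
    rw [div_div_eq_mul_div] at hga hgb
    linear_combination hga + hgb + hsq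
  have hmid : C * (2 * a * b + b ^ 2) ≤ a ^ 2 / 4 + (4 * C ^ 2 + C) * b ^ 2 := by
    linear_combination hab
  have hρ' : e₁ * (4 * C ^ 2 / p + 2 * C) * (a ^ 2 + b ^ 2) ≤ e₂ / 4 * (a ^ 2 + b ^ 2) := by
    gcongr
    linarith
  have hτ' : e₂ * (1 / 4 + 4 * C ^ 2 + C) * b ^ 2 ≤ 1 / 2 * b ^ 2 := by
    gcongr
    linarith
  linear_combination e₁ * hslow + e₂ * hmid + hρ' + hτ'

end ThreeTimeScaleInequality

section ThreeTimeScale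

open Set Filter Topology Metric NNReal

variable {X E H : Type*} [NormedAddCommGroup X] [InnerProductSpace ℝ X]
  [NormedAddCommGroup E] [InnerProductSpace ℝ E]
  [NormedAddCommGroup H] [InnerProductSpace ℝ H]

/-- The linear data of a system with state `(x, η₁, η₂)` in which `x` is fast, `η₂` is intermediate
and `η₁` is slow. The slow variable is read in the coordinate `P η₁`; the quasi-steady values of
`η₂` and of `x` are `-M η₁` and `-(T₁ η₁ + T₂ η₂)`. The deviation `b` of `x` from its quasi-steady
value drives `ẋ = A b`, and together with the deviation `a` of `η₂` it drives `η₂` in the direction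
`-(N a + J b)`. -/
structure ThreeTimeScale (X E H : Type*) [NormedAddCommGroup X] [InnerProductSpace ℝ X]
    [NormedAddCommGroup E] [InnerProductSpace ℝ E]
    [NormedAddCommGroup H] [InnerProductSpace ℝ H] where
  P : E →L[ℝ] E
  M : E →L[ℝ] H
  T₁ : E →L[ℝ] X
  T₂ : H →L[ℝ] X
  A : X →L[ℝ] X
  N : H →L[ℝ] H
  J : X →L[ℝ] H

namespace ThreeTimeScale

variable (D : ThreeTimeScale X E H)

/-- The slow coordinate `P η₁`. -/
def slow : X × E × H →L[ℝ] E :=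
  D.P ∘L .fst ℝ E H ∘L .snd ℝ X (E × H)

/-- The deviation of the intermediate variable from its quasi-steady value. -/
def mid : X × E × H →L[ℝ] H :=
  (.snd ℝ E H + D.M ∘L .fst ℝ E H) ∘L .snd ℝ X (E × H)

/-- The deviation of the fast variable from its quasi-steady value. -/
def fast : X × E × H →L[ℝ] X :=
  .fst ℝ X (E × H) + (D.T₁ ∘L .fst ℝ E H + D.T₂ ∘L .snd ℝ E H) ∘L .snd ℝ X (E × H)

theorem slow_apply (d : X × E × H) : D.slow d = D.P d.2.1 := rfl

theorem mid_apply (d : X × E × H) : D.mid d = d.2.2 + D.M d.2.1 := rfl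

theorem fast_apply (d : X × E × H) : D.fast d = d.1 + (D.T₁ d.2.1 + D.T₂ d.2.2) := rfl

/-- `v` is an admissible velocity at the deviation `d` from the equilibrium for the time constants
`τ₁`, `τ₂`: the slow variable moves along `-g` up to an error that the deviations of the two faster
variables control with gain `c`. -/
structure IsVelocity (c τ₁ τ₂ : ℝ) (g : E) (d v : X × E × H) : Prop where
  fast : v.1 = D.A (D.fast d)
  slow : ∃ r, v.2.1 = -(τ₁⁻¹ • (g + r)) ∧ ‖r‖ ≤ c * (‖D.mid d‖ + ‖D.fast d‖)
  mid : v.2.2 = -(τ₂⁻¹ • (D.N (D.mid d) + D.J (D.fast d)))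

namespace IsVelocity

variable {D} {c τ₁ τ₂ μ : ℝ} {g : E} {d v : X × E × H}

theorem norm_slow_le (hv : D.IsVelocity c τ₁ τ₂ g d v) (hc : 0 ≤ c) (hτ₁ : 0 < τ₁) :
    ‖v.2.1‖ ≤ (1 + c) * (τ₁⁻¹ * (‖g‖ + ‖D.mid d‖ + ‖D.fast d‖)) := by
  obtain ⟨r, hr, hle⟩ := hv.slow
  have hsum : ‖g + r‖ ≤ (1 + c) * (‖g‖ + ‖D.mid d‖ + ‖D.fast d‖) := by
    linarith [norm_add_le g r, mul_nonneg hc (norm_nonneg g), norm_nonneg (D.mid d),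
      norm_nonneg (D.fast d)]
  rw [hr, norm_neg, norm_smul, Real.norm_of_nonneg (inv_nonneg.2 hτ₁.le), mul_left_comm]
  gcongr

theorem norm_mid_le (hv : D.IsVelocity c τ₁ τ₂ g d v) (hτ₂ : 0 < τ₂) :
    ‖v.2.2‖ ≤ (‖D.N‖ + ‖D.J‖) * (τ₂⁻¹ * (‖D.mid d‖ + ‖D.fast d‖)) := by
  have hsum : ‖D.N (D.mid d) + D.J (D.fast d)‖ ≤
      (‖D.N‖ + ‖D.J‖) * (‖D.mid d‖ + ‖D.fast d‖) :=
    calc _ ≤ ‖D.N‖ * ‖D.mid d‖ + ‖D.J‖ * ‖D.fast d‖ :=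
          norm_add_le_of_le (D.N.le_opNorm _) (D.J.le_opNorm _)
      _ ≤ (‖D.N‖ + ‖D.J‖) * (‖D.mid d‖ + ‖D.fast d‖) := by
          linarith [mul_nonneg (norm_nonneg D.N) (norm_nonneg (D.fast d)),
            mul_nonneg (norm_nonneg D.J) (norm_nonneg (D.mid d))]
  rw [hv.mid, norm_neg, norm_smul, Real.norm_of_nonneg (inv_nonneg.2 hτ₂.le), mul_left_comm]
  gcongr

theorem inner_slow_le (hv : D.IsVelocity c τ₁ τ₂ g d v) (hτ₁ : 0 < τ₁)
    (hP : ∀ e, μ * ‖e‖ ^ 2 ≤ inner ℝ e (D.P e)) :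
    inner ℝ g (D.slow v) ≤ -(μ * τ₁⁻¹ * ‖g‖ ^ 2) +
      ‖D.P‖ * c * (τ₁⁻¹ * ‖g‖ * (‖D.mid d‖ + ‖D.fast d‖)) := by
  obtain ⟨r, hr, hle⟩ := hv.slow
  have herror : -inner ℝ g (D.P r) ≤ ‖g‖ * (‖D.P‖ * (c * (‖D.mid d‖ + ‖D.fast d‖))) :=
    calc -inner ℝ g (D.P r) ≤ ‖g‖ * ‖D.P r‖ := (neg_le_abs _).trans (abs_real_inner_le_norm _ _)
      _ ≤ ‖g‖ * (‖D.P‖ * ‖r‖) := by gcongr; exact D.P.le_opNorm r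
      _ ≤ ‖g‖ * (‖D.P‖ * (c * (‖D.mid d‖ + ‖D.fast d‖))) := by gcongr
  calc inner ℝ g (D.slow v) = τ₁⁻¹ * (-inner ℝ g (D.P g) + -inner ℝ g (D.P r)) := by
        rw [D.slow_apply, hr]
        simp only [map_neg, map_smul, map_add, inner_neg_right, real_inner_smul_right,
          inner_add_right]
        ring
    _ ≤ τ₁⁻¹ * (-(μ * ‖g‖ ^ 2) + ‖g‖ * (‖D.P‖ * (c * (‖D.mid d‖ + ‖D.fast d‖)))) := by
        gcongr
        exact hP g
    _ = _ := by ring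

theorem inner_mid_le {Q : H →L[ℝ] H} (hv : D.IsVelocity c τ₁ τ₂ g d v) (hc : 0 ≤ c)
    (hτ₁ : 0 < τ₁) (hτ₂ : 0 < τ₂) (hQ : IsLyapunovOperator (-D.N) Q) :
    2 * inner ℝ (Q (D.mid d)) (D.mid v) ≤ -(τ₂⁻¹ * ‖D.mid d‖ ^ 2) +
      2 * ‖Q‖ * (‖D.J‖ + ‖D.M‖ * (1 + c)) * (‖D.mid d‖ *
        (τ₂⁻¹ * ‖D.fast d‖ + τ₁⁻¹ * (‖g‖ + ‖D.mid d‖ + ‖D.fast d‖))) := by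
  have hτ₂' := inv_pos.2 hτ₂
  set σ := τ₁⁻¹ * (‖g‖ + ‖D.mid d‖ + ‖D.fast d‖)
  set y := D.M v.2.1 - τ₂⁻¹ • D.J (D.fast d)
  have hsplit : D.mid v = τ₂⁻¹ • (-D.N) (D.mid d) + y := by
    rw [D.mid_apply, hv.mid, _root_.neg_apply]
    module
  have hy : ‖y‖ ≤ (‖D.J‖ + ‖D.M‖ * (1 + c)) * (τ₂⁻¹ * ‖D.fast d‖ + σ) :=
    calc ‖y‖ ≤ ‖D.M v.2.1‖ + ‖τ₂⁻¹ • D.J (D.fast d)‖ := norm_sub_le _ _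
      _ ≤ ‖D.M‖ * ((1 + c) * σ) + τ₂⁻¹ * (‖D.J‖ * ‖D.fast d‖) := by
          rw [norm_smul, Real.norm_of_nonneg hτ₂'.le]
          gcongr
          · exact D.M.le_opNorm_of_le (hv.norm_slow_le hc hτ₁)
          · exact D.J.le_opNorm _
      _ ≤ (‖D.J‖ + ‖D.M‖ * (1 + c)) * (τ₂⁻¹ * ‖D.fast d‖ + σ) := by
          have hcross₁ : 0 ≤ ‖D.J‖ * σ := by positivity
          have hcross₂ : 0 ≤ ‖D.M‖ * (1 + c) * (τ₂⁻¹ * ‖D.fast d‖) := by positivity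
          linarith
  calc 2 * inner ℝ (Q (D.mid d)) (D.mid v)
      ≤ -(τ₂⁻¹ * ‖D.mid d‖ ^ 2) + 2 * ‖Q‖ * ‖D.mid d‖ * ‖y‖ := by
        rw [hsplit]
        exact hQ.two_mul_inner_smul_add_le hτ₂'.le _ y
    _ ≤ -(τ₂⁻¹ * ‖D.mid d‖ ^ 2) + 2 * ‖Q‖ * ‖D.mid d‖ *
          ((‖D.J‖ + ‖D.M‖ * (1 + c)) * (τ₂⁻¹ * ‖D.fast d‖ + σ)) := by gcongr
    _ = _ := by ring

theorem inner_fast_le {Q : X →L[ℝ] X} (hv : D.IsVelocity c τ₁ τ₂ g d v) (hc : 0 ≤ c)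
    (hτ₁ : 0 < τ₁) (hτ₂ : 0 < τ₂) (hQ : IsLyapunovOperator D.A Q) :
    2 * inner ℝ (Q (D.fast d)) (D.fast v) ≤ -‖D.fast d‖ ^ 2 +
      2 * ‖Q‖ * (‖D.T₁‖ * (1 + c) + ‖D.T₂‖ * (‖D.N‖ + ‖D.J‖)) * (‖D.fast d‖ *
        (τ₁⁻¹ * (‖g‖ + ‖D.mid d‖ + ‖D.fast d‖) + τ₂⁻¹ * (‖D.mid d‖ + ‖D.fast d‖))) := by
  set σ₁ := τ₁⁻¹ * (‖g‖ + ‖D.mid d‖ + ‖D.fast d‖)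
  set σ₂ := τ₂⁻¹ * (‖D.mid d‖ + ‖D.fast d‖)
  set k := ‖D.T₁‖ * (1 + c) + ‖D.T₂‖ * (‖D.N‖ + ‖D.J‖)
  have hy : ‖D.T₁ v.2.1 + D.T₂ v.2.2‖ ≤ k * (σ₁ + σ₂) :=
    calc _ ≤ ‖D.T₁‖ * ((1 + c) * σ₁) + ‖D.T₂‖ * ((‖D.N‖ + ‖D.J‖) * σ₂) :=
          norm_add_le_of_le (D.T₁.le_opNorm_of_le (hv.norm_slow_le hc hτ₁))
            (D.T₂.le_opNorm_of_le (hv.norm_mid_le hτ₂))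
      _ ≤ k * (σ₁ + σ₂) := by
          have hcross₁ : 0 ≤ ‖D.T₁‖ * (1 + c) * σ₂ := by positivity
          have hcross₂ : 0 ≤ ‖D.T₂‖ * (‖D.N‖ + ‖D.J‖) * σ₁ := by positivity
          linarith
  have hfast := hQ.two_mul_inner_smul_add_le zero_le_one (D.fast d) (D.T₁ v.2.1 + D.T₂ v.2.2)
  rw [one_smul, one_mul, ← hv.fast, ← D.fast_apply] at hfast
  calc 2 * inner ℝ (Q (D.fast d)) (D.fast v)
      ≤ -‖D.fast d‖ ^ 2 + 2 * ‖Q‖ * ‖D.fast d‖ * ‖D.T₁ v.2.1 + D.T₂ v.2.2‖ := hfast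
    _ ≤ -‖D.fast d‖ ^ 2 + 2 * ‖Q‖ * ‖D.fast d‖ * (k * (σ₁ + σ₂)) := by gcongr
    _ = _ := by ring

end IsVelocity

/-- The composite Lyapunov function: the potential `Φ` of the slow coordinate plus quadratic forms
in the two deviations. -/
def lyapunov (Φ : E → ℝ) (Q₂ : H →L[ℝ] H) (Q₃ : X →L[ℝ] X) (d : X × E × H) : ℝ :=
  Φ (D.slow d) - Φ 0 + inner ℝ (Q₂ (D.mid d)) (D.mid d) + inner ℝ (Q₃ (D.fast d)) (D.fast d)

/-- The derivative of `ThreeTimeScale.lyapunov` when `Φ` has gradient `G`. -/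
noncomputable def lyapunovDeriv (G : E → E) (Q₂ : H →L[ℝ] H) (Q₃ : X →L[ℝ] X) (d : X × E × H) :
    X × E × H →L[ℝ] ℝ :=
  innerSL ℝ (G (D.slow d)) ∘L D.slow + ((2 : ℝ) • innerSL ℝ (Q₂ (D.mid d))) ∘L D.mid +
    ((2 : ℝ) • innerSL ℝ (Q₃ (D.fast d))) ∘L D.fast

variable {D} {Φ : E → ℝ} {G : E → E} {Q₂ : H →L[ℝ] H} {Q₃ : X →L[ℝ] X} {d : X × E × H}

theorem lyapunovDeriv_apply (v : X × E × H) :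
    D.lyapunovDeriv G Q₂ Q₃ d v = inner ℝ (G (D.slow d)) (D.slow v) +
      2 * inner ℝ (Q₂ (D.mid d)) (D.mid v) + 2 * inner ℝ (Q₃ (D.fast d)) (D.fast v) := rfl

theorem hasFDerivAt_lyapunov
    (hQ₂ : ∀ v v', inner ℝ (Q₂ v) v' = inner ℝ v (Q₂ v'))
    (hQ₃ : ∀ v v', inner ℝ (Q₃ v) v' = inner ℝ v (Q₃ v'))
    (hΦ : HasFDerivAt Φ (innerSL ℝ (G (D.slow d))) (D.slow d)) :
    HasFDerivAt (D.lyapunov Φ Q₂ Q₃) (D.lyapunovDeriv G Q₂ Q₃ d) d :=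
  (((hΦ.comp d D.slow.hasFDerivAt).sub_const _).add
    ((hasFDerivAt_inner_self_apply hQ₂ (D.mid d)).comp d D.mid.hasFDerivAt)).add
    ((hasFDerivAt_inner_self_apply hQ₃ (D.fast d)).comp d D.fast.hasFDerivAt)

theorem lyapunov_le {ℓ : ℝ} (hℓ : 0 ≤ ℓ) (hΦ : Φ (D.slow d) - Φ 0 ≤ ℓ * ‖D.slow d‖ ^ 2) :
    D.lyapunov Φ Q₂ Q₃ d ≤
      (ℓ * ‖D.slow‖ ^ 2 + ‖Q₂‖ * ‖D.mid‖ ^ 2 + ‖Q₃‖ * ‖D.fast‖ ^ 2) * ‖d‖ ^ 2 := by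
  have hslow : ℓ * ‖D.slow d‖ ^ 2 ≤ ℓ * (‖D.slow‖ * ‖d‖) ^ 2 := by
    gcongr
    exact D.slow.le_opNorm d
  rw [lyapunov]
  linarith [inner_apply_comp_le Q₂ D.mid d, inner_apply_comp_le Q₃ D.fast d]

variable (D) in
theorem exists_norm_sq_le {μ : ℝ} (hμ : 0 < μ) (hP : ∀ e, μ * ‖e‖ ^ 2 ≤ inner ℝ e (D.P e)) :
    ∃ k > (0 : ℝ), ∀ d, ‖d‖ ^ 2 ≤ k * (‖D.slow d‖ ^ 2 + ‖D.mid d‖ ^ 2 + ‖D.fast d‖ ^ 2) := by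
  let k₁ := μ⁻¹
  let k₂ := 1 + ‖D.M‖ * k₁
  let k₃ := 1 + (‖D.T₁‖ * k₁ + ‖D.T₂‖ * k₂)
  refine ⟨3 * (max k₃ (max k₁ k₂)) ^ 2, by positivity, fun d => ?_⟩
  set σ := ‖D.slow d‖ + ‖D.mid d‖ + ‖D.fast d‖
  have hmidσ : ‖D.mid d‖ ≤ σ := by linarith [norm_nonneg (D.slow d), norm_nonneg (D.fast d)]
  have hfastσ : ‖D.fast d‖ ≤ σ := by linarith [norm_nonneg (D.slow d), norm_nonneg (D.mid d)]
  have hslow : ‖d.2.1‖ ≤ k₁ * σ := by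
    rw [← div_eq_inv_mul, le_div_iff₀' hμ]
    refine (mul_norm_le_norm_apply_of_coercive hP _).trans ?_
    rw [← D.slow_apply]
    linarith [norm_nonneg (D.mid d), norm_nonneg (D.fast d)]
  have hmid : ‖d.2.2‖ ≤ k₂ * σ := by
    rw [eq_sub_of_add_eq (D.mid_apply d).symm]
    refine (norm_sub_le_of_le hmidσ (D.M.le_opNorm_of_le hslow)).trans_eq ?_
    ring
  have hfast : ‖d.1‖ ≤ k₃ * σ := by
    rw [eq_sub_of_add_eq (D.fast_apply d).symm]
    refine (norm_sub_le_of_le hfastσ (norm_add_le_of_le (D.T₁.le_opNorm_of_le hslow)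
      (D.T₂.le_opNorm_of_le hmid))).trans_eq ?_
    ring
  have hd : ‖d‖ ≤ max k₃ (max k₁ k₂) * σ := by
    rw [max_mul_of_nonneg _ _ (by positivity), max_mul_of_nonneg _ _ (by positivity)]
    exact max_le_max hfast (max_le_max hslow hmid)
  have hσ : σ ^ 2 ≤ 3 * (‖D.slow d‖ ^ 2 + ‖D.mid d‖ ^ 2 + ‖D.fast d‖ ^ 2) := by
    linarith [sq_nonneg (‖D.slow d‖ - ‖D.mid d‖), sq_nonneg (‖D.slow d‖ - ‖D.fast d‖),
      sq_nonneg (‖D.mid d‖ - ‖D.fast d‖)]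
  calc ‖d‖ ^ 2 ≤ (max k₃ (max k₁ k₂) * σ) ^ 2 := by gcongr
    _ = (max k₃ (max k₁ k₂)) ^ 2 * σ ^ 2 := mul_pow _ _ _
    _ ≤ (max k₃ (max k₁ k₂)) ^ 2 * (3 * (‖D.slow d‖ ^ 2 + ‖D.mid d‖ ^ 2 + ‖D.fast d‖ ^ 2)) := by
        gcongr
    _ = _ := by ring

variable (D) in
theorem exists_mul_norm_sq_le {μ α β γ : ℝ} (hμ : 0 < μ)
    (hP : ∀ e, μ * ‖e‖ ^ 2 ≤ inner ℝ e (D.P e)) (hα : 0 < α) (hβ : 0 < β) (hγ : 0 < γ) :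
    ∃ ε > (0 : ℝ), ∀ d,
      ε * ‖d‖ ^ 2 ≤ α * ‖D.slow d‖ ^ 2 + β * ‖D.mid d‖ ^ 2 + γ * ‖D.fast d‖ ^ 2 := by
  obtain ⟨k, hk, hle⟩ := D.exists_norm_sq_le hμ hP
  let m := min α (min β γ)
  have hm : 0 < m := lt_min hα (lt_min hβ hγ)
  refine ⟨m / k, by positivity, fun d => ?_⟩
  calc m / k * ‖d‖ ^ 2
      ≤ m / k * (k * (‖D.slow d‖ ^ 2 + ‖D.mid d‖ ^ 2 + ‖D.fast d‖ ^ 2)) := by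
        gcongr
        exact hle d
    _ = m * ‖D.slow d‖ ^ 2 + m * ‖D.mid d‖ ^ 2 + m * ‖D.fast d‖ ^ 2 := by
        field_simp
    _ ≤ α * ‖D.slow d‖ ^ 2 + β * ‖D.mid d‖ ^ 2 + γ * ‖D.fast d‖ ^ 2 := by
        gcongr
        exacts [min_le_left _ _, (min_le_right _ _).trans (min_le_left _ _),
          (min_le_right _ _).trans (min_le_right _ _)]

theorem lyapunovDeriv_le {v : X × E × H} {c τ₁ τ₂ μ C : ℝ} (hc : 0 ≤ c) (hτ₁ : 0 < τ₁)
    (hτ₂ : 0 < τ₂) (hP : ∀ e, μ * ‖e‖ ^ 2 ≤ inner ℝ e (D.P e))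
    (hQ₂ : IsLyapunovOperator (-D.N) Q₂) (hQ₃ : IsLyapunovOperator D.A Q₃)
    (hslow : ‖D.P‖ * c ≤ C) (hmid : 2 * ‖Q₂‖ * (‖D.J‖ + ‖D.M‖ * (1 + c)) ≤ C)
    (hfast : 2 * ‖Q₃‖ * (‖D.T₁‖ * (1 + c) + ‖D.T₂‖ * (‖D.N‖ + ‖D.J‖)) ≤ C)
    (hv : D.IsVelocity c τ₁ τ₂ (G (D.slow d)) d v) :
    D.lyapunovDeriv G Q₂ Q₃ d v ≤
      -(μ * τ₁⁻¹ * ‖G (D.slow d)‖ ^ 2 + τ₂⁻¹ * ‖D.mid d‖ ^ 2 + ‖D.fast d‖ ^ 2) +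
      C * (τ₁⁻¹ * ‖G (D.slow d)‖ * (‖D.mid d‖ + ‖D.fast d‖) +
        ‖D.mid d‖ * (τ₂⁻¹ * ‖D.fast d‖ + τ₁⁻¹ * (‖G (D.slow d)‖ + ‖D.mid d‖ + ‖D.fast d‖)) +
        ‖D.fast d‖ * (τ₁⁻¹ * (‖G (D.slow d)‖ + ‖D.mid d‖ + ‖D.fast d‖) +
          τ₂⁻¹ * (‖D.mid d‖ + ‖D.fast d‖))) := by
  have hs := (hv.inner_slow_le hτ₁ hP).trans
    (add_le_add_right (mul_le_mul_of_nonneg_right hslow (by positivity)) _)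
  have hm := (hv.inner_mid_le hc hτ₁ hτ₂ hQ₂).trans
    (add_le_add_right (mul_le_mul_of_nonneg_right hmid (by positivity)) _)
  have hf := (hv.inner_fast_le hc hτ₁ hτ₂ hQ₃).trans
    (add_le_add_right (mul_le_mul_of_nonneg_right hfast (by positivity)) _)
  rw [lyapunovDeriv_apply]
  linear_combination hs + hm + hf

variable (D) in
theorem exists_lyapunovDeriv_le {c μ : ℝ} (hc : 0 ≤ c) (hμ : 0 < μ)
    (hP : ∀ e, μ * ‖e‖ ^ 2 ≤ inner ℝ e (D.P e))
    (hQ₂ : IsLyapunovOperator (-D.N) Q₂) (hQ₃ : IsLyapunovOperator D.A Q₃) :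
    ∃ τstar > (0 : ℝ), ∃ ρ > (0 : ℝ), ∀ τ₁ τ₂, τstar < τ₂ → ρ * τ₂ < τ₁ → 0 < τ₁ ∧ 0 < τ₂ ∧
      ∀ (G : E → E) (d v : X × E × H), D.IsVelocity c τ₁ τ₂ (G (D.slow d)) d v →
        D.lyapunovDeriv G Q₂ Q₃ d v ≤
          -(μ * τ₁⁻¹ * ‖G (D.slow d)‖ ^ 2 + τ₂⁻¹ * ‖D.mid d‖ ^ 2 + ‖D.fast d‖ ^ 2) / 2 := by
  set C₁ := ‖D.P‖ * c
  set C₂ := 2 * ‖Q₂‖ * (‖D.J‖ + ‖D.M‖ * (1 + c))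
  set C₃ := 2 * ‖Q₃‖ * (‖D.T₁‖ * (1 + c) + ‖D.T₂‖ * (‖D.N‖ + ‖D.J‖))
  have hC₁ : 0 ≤ C₁ := by positivity
  obtain ⟨τstar, hτstar, ρ, hρ, hcoupling⟩ :=
    exists_three_timeScale_coupling_le hμ (hC₁.trans (le_max_left C₁ (max C₂ C₃)))
  refine ⟨τstar, hτstar, ρ, hρ, fun τ₁ τ₂ hτ₂star hτ₁₂ => ?_⟩
  have hτ₂ : 0 < τ₂ := hτstar.trans hτ₂star
  have hτ₁ : 0 < τ₁ := (mul_pos hρ hτ₂).trans hτ₁₂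
  refine ⟨hτ₁, hτ₂, fun G d v hv => ?_⟩
  have hinv₂ : τ₂⁻¹ * τstar < 1 := by rwa [← div_eq_inv_mul, div_lt_one hτ₂]
  have hinv₁ : ρ * τ₁⁻¹ < τ₂⁻¹ := by
    rwa [← div_eq_mul_inv, div_lt_iff₀ hτ₁, ← div_eq_inv_mul, lt_div_iff₀ hτ₂]
  have hle := lyapunovDeriv_le hc hτ₁ hτ₂ hP hQ₂ hQ₃ (le_max_left C₁ (max C₂ C₃))
    ((le_max_left C₂ C₃).trans (le_max_right _ _))
    ((le_max_right C₂ C₃).trans (le_max_right _ _)) hv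
  linarith [hcoupling τ₁⁻¹ τ₂⁻¹ (inv_pos.2 hτ₁) (inv_pos.2 hτ₂) hinv₂ hinv₁
    ‖G (D.slow d)‖ ‖D.mid d‖ ‖D.fast d‖]

theorem exists_isQuadraticLyapunovOn {F : X × E × H → X × E × H} {B : Set (X × E × H)}
    {p : X × E × H} {s : Set E} {c κ ℓ μ τ₁ τ₂ : ℝ} (hμ : 0 < μ)
    (hP : ∀ e, μ * ‖e‖ ^ 2 ≤ inner ℝ e (D.P e))
    (hQ₂ : IsLyapunovOperator (-D.N) Q₂) (hQ₃ : IsLyapunovOperator D.A Q₃)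
    (hτ₁ : 0 < τ₁) (hτ₂ : 0 < τ₂)
    (hdecrease : ∀ d v, D.IsVelocity c τ₁ τ₂ (G (D.slow d)) d v → D.lyapunovDeriv G Q₂ Q₃ d v ≤
      -(μ * τ₁⁻¹ * ‖G (D.slow d)‖ ^ 2 + τ₂⁻¹ * ‖D.mid d‖ ^ 2 + ‖D.fast d‖ ^ 2) / 2)
    (hΦ : HasQuadraticGrowthOn Φ G s κ ℓ) (hs : ∀ x ∈ B, D.slow (x - p) ∈ s)
    (hF : ∀ x ∈ B, D.IsVelocity c τ₁ τ₂ (G (D.slow (x - p))) (x - p) (F x)) :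
    ∃ c₁ c₂ c₃, IsQuadraticLyapunovOn F B p (fun x => D.lyapunov Φ Q₂ Q₃ (x - p))
      (fun x => D.lyapunovDeriv G Q₂ Q₃ (x - p)) c₁ c₂ c₃ := by
  have hκ := hΦ.lower_pos
  have hℓ := hΦ.upper_nonneg
  obtain ⟨α₂, hα₂, hcoercive₂⟩ := hQ₂.coercive
  obtain ⟨α₃, hα₃, hcoercive₃⟩ := hQ₃.coercive
  obtain ⟨c₁, hc₁, hlower⟩ := D.exists_mul_norm_sq_le hμ hP (half_pos hκ) hα₂ hα₃
  obtain ⟨c₃, hc₃, hrate⟩ := D.exists_mul_norm_sq_le (α := μ * τ₁⁻¹ * κ ^ 2 / 2)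
    (β := τ₂⁻¹ / 2) hμ hP (by positivity) (by positivity) one_half_pos
  refine ⟨c₁, ℓ * ‖D.slow‖ ^ 2 + ‖Q₂‖ * ‖D.mid‖ ^ 2 + ‖Q₃‖ * ‖D.fast‖ ^ 2 + 1, c₃,
    hc₁, by positivity, hc₃, fun x hx => ?_, fun x hx => ?_, fun x hx => ?_, fun x hx => ?_⟩
  · exact (hasFDerivAt_lyapunov hQ₂.symm hQ₃.symm (hΦ.hasFDerivAt _ (hs x hx))).comp x
      ((hasFDerivAt_id x).sub_const p)
  · refine (hlower _).trans ?_
    rw [lyapunov]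
    linarith [hΦ.lower _ (hs x hx), hcoercive₂ (D.mid (x - p)), hcoercive₃ (D.fast (x - p))]
  · refine (lyapunov_le hℓ (hΦ.upper _ (hs x hx))).trans ?_
    gcongr ?_ * _
    exact le_add_of_nonneg_right zero_le_one
  · have hgrad : μ * τ₁⁻¹ * (κ * ‖D.slow (x - p)‖) ^ 2 ≤
        μ * τ₁⁻¹ * ‖G (D.slow (x - p))‖ ^ 2 := by
      gcongr
      exact hΦ.gradient _ (hs x hx)
    linarith [hdecrease _ _ (hF x hx), hrate (x - p)]

variable (D) in
theorem exists_forall_isLocallyExpStable [CompleteSpace X] [CompleteSpace E] [CompleteSpace H]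
    {c μ : ℝ} (hc : 0 ≤ c) (hμ : 0 < μ) (hP : ∀ e, μ * ‖e‖ ^ 2 ≤ inner ℝ e (D.P e))
    (hN : ∃ Q, IsLyapunovOperator (-D.N) Q) (hA : ∃ Q, IsLyapunovOperator D.A Q) :
    ∃ τstar > (0 : ℝ), ∃ ρ > (0 : ℝ), ∀ τ₁ τ₂, τstar < τ₂ → ρ * τ₂ < τ₁ →
      ∀ (F : X × E × H → X × E × H) (Ω : Set (X × E × H)) (p : X × E × H) (Φ : E → ℝ)
        (G : E → E) (s : Set E) (κ ℓ : ℝ), Ω ∈ 𝓝 p →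
        (∃ K : ℝ≥0, ∃ t ∈ 𝓝 p, LipschitzOnWith K F t) →
        s ∈ 𝓝 0 → HasQuadraticGrowthOn Φ G s κ ℓ →
        (∀ᶠ x in 𝓝 p, D.IsVelocity c τ₁ τ₂ (G (D.slow (x - p))) (x - p) (F x)) →
        IsLocallyExpStable F Ω p := by
  obtain ⟨Q₂, hQ₂⟩ := hN
  obtain ⟨Q₃, hQ₃⟩ := hA
  obtain ⟨τstar, hτstar, ρ, hρ, hdecrease⟩ := D.exists_lyapunovDeriv_le hc hμ hP hQ₂ hQ₃
  refine ⟨τstar, hτstar, ρ, hρ, fun τ₁ τ₂ hτ₂star hτ₁₂ F Ω p Φ G s κ ℓ hΩ ⟨K, t, ht, hlip⟩ hs hΦ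
    hF => ?_⟩
  obtain ⟨hτ₁, hτ₂, hle⟩ := hdecrease τ₁ τ₂ hτ₂star hτ₁₂
  have hslow : ∀ᶠ x in 𝓝 p, D.slow (x - p) ∈ s := by
    refine (D.slow.continuous.comp (continuous_id.sub continuous_const)).continuousAt ?_
    simpa using hs
  obtain ⟨R, hR, hball⟩ := nhds_basis_closedBall.eventually_iff.1
    (hslow.and (hF.and ((eventually_mem_set.2 hΩ).and (eventually_mem_set.2 ht))))
  obtain ⟨c₁, c₂, c₃, hV⟩ := exists_isQuadraticLyapunovOn hμ hP hQ₂ hQ₃ hτ₁ hτ₂ (hle G) hΦ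
    (fun x hx => (hball hx).1) (fun x hx => (hball hx).2.1)
  exact hV.isLocallyExpStable hR (fun x hx => (hball hx).2.2.1)
    (hlip.mono fun x hx => (hball hx).2.2.2)

end ThreeTimeScale
end ThreeTimeScale

/-! ### Strongly convex functions -/

section StrongConvexity

open Set Filter Topology Metric NNReal

theorem add_fderiv_add_sq_le_of_strongConvexOn {E : Type*} [NormedAddCommGroup E]
    [NormedSpace ℝ E] {s : Set E} {κ : ℝ} {f : E → ℝ} {f' : E →L[ℝ] ℝ} {x y : E}
    (hf : StrongConvexOn s κ f) (hx : x ∈ s) (hy : y ∈ s) (hf' : HasFDerivAt f f' x) :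
    f x + f' (y - x) + κ / 2 * ‖y - x‖ ^ 2 ≤ f y := by
  have hderiv : HasDerivAt (fun t : ℝ => f (x + t • (y - x))) (f' (y - x)) 0 :=
    hf'.hasLineDerivAt (y - x)
  have hslope := hderiv.tendsto_slope.mono_left (nhdsGT_le_nhdsNE 0)
  have hchord : ∀ᶠ t in 𝓝[>] (0 : ℝ), slope (fun t : ℝ => f (x + t • (y - x))) 0 t ≤
      f y - f x - (1 - t) * (κ / 2 * ‖y - x‖ ^ 2) := by
    filter_upwards [Ioo_mem_nhdsGT one_pos] with t ⟨ht, ht1⟩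
    have hconv := hf.2 hx hy (sub_nonneg.2 ht1.le) ht.le (sub_add_cancel 1 t)
    rw [show (1 - t) • x + t • y = x + t • (y - x) by module, norm_sub_rev, smul_eq_mul,
      smul_eq_mul] at hconv
    rw [slope_def_field, sub_zero, zero_smul, add_zero, div_le_iff₀ ht]
    linarith
  have hlimit : Tendsto (fun t : ℝ => f y - f x - (1 - t) * (κ / 2 * ‖y - x‖ ^ 2)) (𝓝[>] 0)
      (𝓝 (f y - f x - (1 - 0) * (κ / 2 * ‖y - x‖ ^ 2))) :=
    (Continuous.tendsto (by fun_prop) 0).mono_left nhdsWithin_le_nhds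
  have hle := le_of_tendsto_of_tendsto hslope hlimit hchord
  linarith

theorem hasQuadraticGrowthOn_of_strongConvexOn {E : Type*} [NormedAddCommGroup E]
    [InnerProductSpace ℝ E] {D s : Set E} {κ : ℝ} {Φ : E → ℝ} {G : E → E} {L : ℝ≥0}
    (hκ : 0 < κ) (hΦ : StrongConvexOn D κ Φ) (hsD : s ⊆ D) (h0 : 0 ∈ s)
    (hG : ∀ ξ ∈ s, HasFDerivAt Φ (innerSL ℝ (G ξ)) ξ) (hG0 : G 0 = 0)
    (hL : LipschitzOnWith L G s) : HasQuadraticGrowthOn Φ G s κ L := by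
  have hlower (ξ : E) (hξ : ξ ∈ s) : κ / 2 * ‖ξ‖ ^ 2 ≤ Φ ξ - Φ 0 := by
    have hle := add_fderiv_add_sq_le_of_strongConvexOn hΦ (hsD h0) (hsD hξ) (hG 0 h0)
    rw [hG0, map_zero, _root_.zero_apply, sub_zero] at hle
    linarith
  have hinner (ξ : E) (hξ : ξ ∈ s) : Φ ξ - Φ 0 + κ / 2 * ‖ξ‖ ^ 2 ≤ ‖G ξ‖ * ‖ξ‖ := by
    have hle := add_fderiv_add_sq_le_of_strongConvexOn hΦ (hsD hξ) (hsD h0) (hG ξ hξ)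
    rw [zero_sub, map_neg, innerSL_apply_apply, norm_neg] at hle
    linarith [real_inner_le_norm (G ξ) ξ]
  refine ⟨hκ, L.2, hG, hlower, fun ξ hξ => ?_, fun ξ hξ => ?_⟩
  · have hnorm : ‖G ξ‖ ≤ L * ‖ξ‖ := by
      simpa [hG0, dist_eq_norm] using hL.dist_le_mul ξ hξ 0 h0
    calc Φ ξ - Φ 0 ≤ ‖G ξ‖ * ‖ξ‖ := by
          have hsq : 0 ≤ κ / 2 * ‖ξ‖ ^ 2 := by positivity
          linarith [hinner ξ hξ]
      _ ≤ L * ‖ξ‖ * ‖ξ‖ := by gcongr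
      _ = L * ‖ξ‖ ^ 2 := by ring
  · rcases (norm_nonneg ξ).eq_or_lt with hzero | hpos
    · simp [← hzero]
    · refine le_of_mul_le_mul_right ?_ hpos
      linarith [hlower ξ hξ, hinner ξ hξ]

theorem norm_lt_of_convexOn_of_forall_sphere_lt {E : Type*} [NormedAddCommGroup E]
    [NormedSpace ℝ E] {D : Set E} {J : E → ℝ} {δ : ℝ} (hJ : ConvexOn ℝ D J) (hδ : 0 < δ)
    (hlt : ∀ ξ ∈ sphere (0 : E) δ, J 0 < J ξ) (h0 : 0 ∈ D) {ξ : E} (hξ : ξ ∈ D)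
    (hle : J ξ ≤ J 0) : ‖ξ‖ < δ := by
  by_contra! hge
  have hpos : 0 < ‖ξ‖ := hδ.trans_le hge
  have hmem : (δ / ‖ξ‖) • ξ ∈ sphere (0 : E) δ := by
    rw [mem_sphere_zero_iff_norm, norm_smul, Real.norm_of_nonneg (by positivity),
      div_mul_cancel₀ _ hpos.ne']
  have hsegment : (δ / ‖ξ‖) • ξ ∈ segment ℝ 0 ξ :=
    (segment_eq_image ℝ 0 ξ).symm ▸ ⟨δ / ‖ξ‖, ⟨by positivity, (div_le_one hpos).2 hge⟩, by simp⟩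
  refine (hlt _ hmem).not_ge ?_
  exact (hJ.le_on_segment h0 hξ hsegment).trans_eq (max_eq_left hle)

theorem eventually_forall_norm_lt_of_convexOn {W E : Type*} [TopologicalSpace W]
    [NormedAddCommGroup E] [NormedSpace ℝ E] [ProperSpace E] {J : W → E → ℝ} {D : W → Set E}
    {s : Set W} {w₀ : W} {δ : ℝ} (hδ : 0 < δ) (hJ : ∀ w ∈ s, ConvexOn ℝ (D w) (J w))
    (hcont : ∀ ξ ∈ closedBall (0 : E) δ, ContinuousAt (fun x : W × E => J x.1 x.2) (w₀, ξ))
    (hlt : ∀ ξ ∈ sphere (0 : E) δ, J w₀ 0 < J w₀ ξ) :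
    ∀ᶠ w in 𝓝[s] w₀, 0 ∈ D w → ∀ ξ ∈ D w, J w ξ ≤ J w 0 → ‖ξ‖ < δ := by
  have hcenter : ContinuousAt (fun w => J w 0) w₀ :=
    ContinuousAt.comp (f := fun w => (w, (0 : E))) (hcont 0 (mem_closedBall_self hδ.le))
      (by fun_prop)
  have hsphere : ∀ᶠ w in 𝓝 w₀, ∀ ξ ∈ sphere (0 : E) δ, J w 0 < J w ξ :=
    (isCompact_sphere (0 : E) δ).eventually_forall_of_forall_eventually fun ξ hξ =>
      hcenter.fst'.eventually_lt (hcont ξ (sphere_subset_closedBall hξ)) (hlt ξ hξ)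
  filter_upwards [self_mem_nhdsWithin, mem_nhdsWithin_of_mem_nhds hsphere] with w hw hlt' h0 ξ hξ
  exact norm_lt_of_convexOn_of_forall_sphere_lt (hJ w hw) hδ hlt' h0 hξ

end StrongConvexity

/-! ### The feasible subspace and the controller gains -/

section Rank

open Module

variable {K ι κ : Type*} [Field K] [Fintype κ]

theorem mulVec_injective_iff_rank_eq_card {M : Matrix ι κ K} :
    Function.Injective M.mulVec ↔ M.rank = Fintype.card κ := by
  rw [Matrix.mulVec_injective_iff, linearIndependent_iff_card_eq_finrank_span, Set.finrank,
    ← Matrix.rank_eq_finrank_span_cols, eq_comm]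

theorem exists_mul_eq_one_of_rank_eq_card [Fintype ι] [DecidableEq ι] {M : Matrix ι κ K}
    (h : M.rank = Fintype.card ι) : ∃ R : Matrix κ ι K, M * R = 1 := by
  refine Matrix.mulVec_surjective_iff_exists_right_inverse.1
    (LinearMap.range_eq_top (f := M.mulVecLin).1 (Submodule.eq_top_of_finrank_eq ?_))
  rw [← Matrix.rank, h, finrank_fintype_fun_eq_card]

end Rank

section BlockMatrices

variable {a b c d : ℕ}

theorem sumElim_mem_range_fromRows_iff (M₁ : Matrix (Fin a) (Fin c) ℝ)
    (M₂ : Matrix (Fin b) (Fin c) ℝ) (x : Vec a) (y : Vec b) :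
    Sum.elim x.ofLp y.ofLp ∈ LinearMap.range (fromRows M₁ M₂).mulVecLin ↔
      ∃ ξ : Vec c, M₁ *ₑ ξ = x ∧ M₂ *ₑ ξ = y := by
  rw [LinearMap.mem_range, (WithLp.equiv 2 (Fin c → ℝ)).exists_congr_left]
  refine exists_congr fun ξ => ?_
  rw [mulVecLin_apply, fromRows_mulVec, Sum.elim_eq_iff, WithLp.ext_iff, WithLp.ext_iff]
  rfl

theorem sumElim_mem_ker_fromBlocks_iff (A : Matrix (Fin c) (Fin a) ℝ) (B : Matrix (Fin c) (Fin b) ℝ)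
    (C : Matrix (Fin d) (Fin a) ℝ) (D : Matrix (Fin d) (Fin b) ℝ) (x : Vec a) (y : Vec b) :
    Sum.elim x.ofLp y.ofLp ∈ LinearMap.ker (fromBlocks A B C D).mulVecLin ↔
      A *ₑ x + B *ₑ y = 0 ∧ C *ₑ x + D *ₑ y = 0 := by
  rw [LinearMap.mem_ker, mulVecLin_apply, fromBlocks_mulVec, ← Sum.elim_zero_zero,
    Sum.elim_eq_iff, WithLp.ext_iff, WithLp.ext_iff]
  rfl

end BlockMatrices

section FeasibleSubspace

variable {n m r nw nc q : ℕ} {S : Plant n m r nw} {O : OSSData m r nw nc}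
  {Tz : Matrix (Fin r) (Fin q) ℝ} {Tu : Matrix (Fin m) (Fin q) ℝ}

theorem constraintGain_matAct (u : Vec m) :
    constraintGain S O *ₑ u = O.Hz *ₑ (S.Gu *ₑ u) + O.Hu *ₑ u := by
  rw [constraintGain, matAct_add_matrix, matAct_mul]

namespace SpansFeasibleSubspace

theorem exists_iff (hT : SpansFeasibleSubspace S O Tz Tu) (z : Vec r) (u : Vec m) :
    (∃ ξ : Vec q, Tz *ₑ ξ = z ∧ Tu *ₑ ξ = u) ↔ z = S.Gu *ₑ u ∧ constraintGain S O *ₑ u = 0 := by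
  rw [← sumElim_mem_range_fromRows_iff, hT, sumElim_mem_ker_fromBlocks_iff, matAct_one,
    matAct_neg_matrix, add_neg_eq_zero, constraintGain_matAct]
  exact and_congr_right fun hz => by rw [hz]

theorem Tz_eq (hT : SpansFeasibleSubspace S O Tz Tu) (ξ : Vec q) :
    Tz *ₑ ξ = S.Gu *ₑ (Tu *ₑ ξ) :=
  ((hT.exists_iff _ _).1 ⟨ξ, rfl, rfl⟩).1

theorem constraintGain_Tu (hT : SpansFeasibleSubspace S O Tz Tu) (ξ : Vec q) :
    constraintGain S O *ₑ (Tu *ₑ ξ) = 0 :=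
  ((hT.exists_iff _ _).1 ⟨ξ, rfl, rfl⟩).2

theorem exists_of_constraintGain_eq_zero (hT : SpansFeasibleSubspace S O Tz Tu) {u : Vec m}
    (hu : constraintGain S O *ₑ u = 0) : ∃ ξ : Vec q, Tu *ₑ ξ = u :=
  ((hT.exists_iff (S.Gu *ₑ u) u).2 ⟨rfl, hu⟩).imp fun _ h => h.2

theorem Tu_injective (hT : SpansFeasibleSubspace S O Tz Tu)
    (hTrank : (fromRows Tz Tu).rank = q) {ξ ξ' : Vec q} (h : Tu *ₑ ξ = Tu *ₑ ξ') : ξ = ξ' := by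
  have hz : Tz *ₑ ξ = Tz *ₑ ξ' := by rw [hT.Tz_eq, hT.Tz_eq, h]
  refine WithLp.ofLp_injective 2 (mulVec_injective_iff_rank_eq_card.2 (by simpa using hTrank) ?_)
  rw [fromRows_mulVec, fromRows_mulVec]
  exact Sum.elim_eq_iff.2 ⟨congrArg WithLp.ofLp hz, congrArg WithLp.ofLp h⟩

end SpansFeasibleSubspace

namespace SteadyStateConstraints

variable {w : Vec nw} {z z' : Vec r} {u u' : Vec m}

theorem iff_constraintGain : SteadyStateConstraints S O w z u ↔
    z = S.Gu *ₑ u + S.Gw *ₑ w ∧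
      constraintGain S O *ₑ u + (O.Hz *ₑ (S.Gw *ₑ w) + O.Hw *ₑ w) = 0 := by
  refine and_congr_right fun hz => ?_
  rw [eq_comm, hz, constraintGain_matAct, matAct_add]
  abel_nf

theorem shift (hT : SpansFeasibleSubspace S O Tz Tu) (h : SteadyStateConstraints S O w z u)
    (ξ : Vec q) : SteadyStateConstraints S O w (Tz *ₑ ξ + z) (Tu *ₑ ξ + u) := by
  rw [iff_constraintGain] at h ⊢
  rw [matAct_add, matAct_add, hT.constraintGain_Tu, zero_add, hT.Tz_eq, h.1]
  exact ⟨(add_assoc _ _ _).symm, h.2⟩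

theorem exists_eq_shift (hT : SpansFeasibleSubspace S O Tz Tu)
    (h : SteadyStateConstraints S O w z u) (h' : SteadyStateConstraints S O w z' u') :
    ∃ ξ : Vec q, z' = Tz *ₑ ξ + z ∧ u' = Tu *ₑ ξ + u := by
  rw [iff_constraintGain] at h h'
  obtain ⟨ξ, hz, hu⟩ := (hT.exists_iff (z' - z) (u' - u)).2 ⟨by rw [h.1, h'.1, matAct_sub]; abel, by
    rw [matAct_sub, sub_eq_zero]
    exact add_right_cancel (h'.2.trans h.2.symm)⟩
  exact ⟨ξ, by rw [hz, sub_add_cancel], by rw [hu, sub_add_cancel]⟩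

theorem exists_disturbance_shift (hN : (constraintGain S O).rank = nc) :
    ∃ (Lz : Vec nw →L[ℝ] Vec r) (Lu : Vec nw →L[ℝ] Vec m), ∀ w w' z u,
      SteadyStateConstraints S O w z u →
        SteadyStateConstraints S O w' (z + Lz (w' - w)) (u + Lu (w' - w)) := by
  obtain ⟨R, hR⟩ := exists_mul_eq_one_of_rank_eq_card (hN.trans (Fintype.card_fin nc).symm)
  have hNR : ∀ v, constraintGain S O *ₑ (R *ₑ v) = v := fun v => by
    rw [← matAct_mul, hR, matAct_one]
  let Lu := matCLM (-(R * (O.Hz * S.Gw + O.Hw)))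
  refine ⟨matCLM S.Gu ∘L Lu + matCLM S.Gw, Lu, fun w w' z u h => ?_⟩
  rw [iff_constraintGain] at h ⊢
  simp only [Lu, _root_.add_apply, ContinuousLinearMap.comp_apply, matCLM_apply,
    matAct_neg_matrix, matAct_mul, matAct_add_matrix, matAct_add, matAct_sub, matAct_neg, hNR]
  constructor
  · linear_combination (norm := module) h.1
  · linear_combination (norm := module) h.2

end SteadyStateConstraints

end FeasibleSubspace

section Gains

variable {n m r nw nc q : ℕ} {S : Plant n m r nw} {O : OSSData m r nw nc}
  {Tz : Matrix (Fin r) (Fin q) ℝ} {Tu : Matrix (Fin m) (Fin q) ℝ}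
  {K₁ : Matrix (Fin m) (Fin q) ℝ} {K₂ : Matrix (Fin m) (Fin nc) ℝ} {P : Matrix (Fin q) (Fin q) ℝ}

open Metric in
theorem exists_mul_norm_sq_le_inner {E : Type*} [NormedAddCommGroup E] [InnerProductSpace ℝ E]
    [ProperSpace E] (T : E →L[ℝ] E) (hT : ∀ v ≠ 0, 0 < inner ℝ v (T v)) :
    ∃ μ > 0, ∀ v, μ * ‖v‖ ^ 2 ≤ inner ℝ v (T v) := by
  obtain ⟨μ, hμ, hle⟩ := (isCompact_sphere (0 : E) 1).exists_forall_le'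
    (f := fun v => inner ℝ v (T v)) (by fun_prop)
    fun v hv => hT v (ne_of_mem_sphere hv one_ne_zero)
  refine ⟨μ, hμ, fun v => ?_⟩
  rcases eq_or_ne v 0 with rfl | hv
  · simp
  · have hunit := hle (‖v‖⁻¹ • v) (by simp [norm_smul, hv])
    rw [map_smul, inner_smul_left, inner_smul_right, conj_trivial] at hunit
    have := norm_pos_iff.2 hv
    field_simp at hunit
    linarith

theorem isUnit_of_forall_ne_zero_inner_pos (hP : ∀ v : Vec q, v ≠ 0 → 0 < inner ℝ v (P *ₑ v)) :
    IsUnit P := by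
  refine mulVec_injective_iff_isUnit.1 ((injective_iff_map_eq_zero P.mulVecLin).2 fun x hx => ?_)
  by_contra hne
  have hpos := hP (WithLp.toLp 2 x) (by simpa using hne)
  have hPx : P *ₑ WithLp.toLp 2 x = 0 := congrArg (WithLp.toLp 2) hx
  simp [hPx] at hpos

theorem inner_matAct_pos_of_posDef (hP : P.PosDef) {v : Vec q} (hv : v ≠ 0) :
    0 < inner ℝ v (P *ₑ v) := by
  rw [show inner ℝ v (P *ₑ v) = v ⬝ᵥ P *ᵥ v from Matrix.inner_toEuclideanCLM P v v]
  exact hP.dotProduct_mulVec_pos (by simpa using hv)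

theorem gain_splitting (hK₁ : projC (constraintGain S O) K₂ * K₁ = Tu * P) (e : Vec q)
    (h : Vec nc) :
    K₁ *ₑ e + K₂ *ₑ h = Tu *ₑ (P *ₑ e) +
      K₂ *ₑ (h + ((constraintGain S O * K₂)⁻¹ * (constraintGain S O * K₁)) *ₑ e) := by
  have hproj := congrArg (fun X => X *ₑ e) hK₁
  simp only [projC, matAct_mul, matAct_sub_matrix, matAct_one] at hproj
  rw [← hproj, matAct_add, matAct_mul, matAct_mul]
  abel

theorem gain_injective (hT : SpansFeasibleSubspace S O Tz Tu)
    (hTrank : (fromRows Tz Tu).rank = q) (hNK : IsUnit (constraintGain S O * K₂))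
    (hP : IsUnit P) (hK₁ : projC (constraintGain S O) K₂ * K₁ = Tu * P) {e : Vec q}
    {h : Vec nc} (h0 : K₁ *ₑ e + K₂ *ₑ h = 0) : e = 0 ∧ h = 0 := by
  rw [gain_splitting hK₁] at h0
  set a := h + ((constraintGain S O * K₂)⁻¹ * (constraintGain S O * K₁)) *ₑ e with ha
  have hNKa : (constraintGain S O * K₂) *ₑ a = 0 := by
    simpa only [matAct_add, hT.constraintGain_Tu, zero_add, matAct_mul, matAct_zero] using
      congrArg (fun v => constraintGain S O *ₑ v) h0
  have ha0 : a = 0 := by rw [← nonsing_inv_matAct hNK a, hNKa, matAct_zero]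
  rw [ha0, matAct_zero, add_zero] at h0
  have he : e = 0 := by
    rw [← nonsing_inv_matAct hP e, hT.Tu_injective hTrank (h0.trans (matAct_zero Tu).symm),
      matAct_zero]
  rw [he, matAct_zero, add_zero] at ha
  exact ⟨he, ha.symm.trans ha0⟩

theorem gain_surjective (hT : SpansFeasibleSubspace S O Tz Tu)
    (hNK : IsUnit (constraintGain S O * K₂)) (hP : IsUnit P)
    (hK₁ : projC (constraintGain S O) K₂ * K₁ = Tu * P) (u : Vec m) :
    ∃ (e : Vec q) (h : Vec nc), K₁ *ₑ e + K₂ *ₑ h = u := by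
  set a : Vec nc := (constraintGain S O * K₂)⁻¹ *ₑ (constraintGain S O *ₑ u)
  obtain ⟨ξ, hξ⟩ := hT.exists_of_constraintGain_eq_zero (u := u - K₂ *ₑ a) (by
    rw [matAct_sub, ← matAct_mul, matAct_nonsing_inv hNK, sub_self])
  refine ⟨P⁻¹ *ₑ ξ, a - ((constraintGain S O * K₂)⁻¹ * (constraintGain S O * K₁)) *ₑ (P⁻¹ *ₑ ξ),
    ?_⟩
  rw [gain_splitting hK₁, matAct_nonsing_inv hP, hξ, sub_add_cancel, sub_add_cancel]

theorem isHurwitz_neg_one (k : ℕ) : IsHurwitz (-1 : Matrix (Fin k) (Fin k) ℝ) := by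
  intro s hs
  have hmap : (-1 : Matrix (Fin k) (Fin k) ℝ).map (algebraMap ℝ ℂ) = algebraMap ℂ _ (-1) := by
    rw [map_neg, map_one, ← RingHom.mapMatrix_apply, map_neg, map_one]
  rw [hmap] at hs
  rcases subsingleton_or_nontrivial (Matrix (Fin k) (Fin k) ℂ) with _ | _
  · simp [spectrum.of_subsingleton] at hs
  · rw [spectrum.scalar_eq, Set.mem_singleton_iff] at hs
    simp [hs]

theorem exists_isHurwitz_neg_mul {N : Matrix (Fin nc) (Fin m) ℝ} (hN : N.rank = nc) :
    ∃ K₂ : Matrix (Fin m) (Fin nc) ℝ, IsHurwitz (-(N * K₂)) := by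
  obtain ⟨R, hR⟩ := exists_mul_eq_one_of_rank_eq_card (hN.trans (Fintype.card_fin nc).symm)
  exact ⟨R, by rw [hR]; exact isHurwitz_neg_one nc⟩

theorem exists_slow_gain (hT : SpansFeasibleSubspace S O Tz Tu)
    (hTrank : (fromRows Tz Tu).rank = q) (hP : IsUnit P) :
    ∃ K₁ : Matrix (Fin m) (Fin q) ℝ,
      K₁.rank = q ∧ projC (constraintGain S O) K₂ * K₁ = Tu * P := by
  have hinj : Function.Injective fun v : Vec q => (Tu * P) *ₑ v := fun v v' h => by
    simp only [matAct_mul] at h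
    rw [← nonsing_inv_matAct hP v, hT.Tu_injective hTrank h, nonsing_inv_matAct hP]
  refine ⟨Tu * P, ?_, eq_of_forall_matAct_eq fun v => ?_⟩
  · rw [mulVec_injective_iff_rank_eq_card.1 fun x y hxy =>
      WithLp.toLp_injective 2 (hinj (congrArg (WithLp.toLp 2) hxy)), Fintype.card_fin]
  · simp only [projC, matAct_mul, matAct_sub_matrix, matAct_one, hT.constraintGain_Tu,
      matAct_zero, sub_zero]

theorem Plant.output_eq_of_equilibrium (hA : IsUnit S.A) {x : Vec n} {u : Vec m} {w : Vec nw}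
    (hx : S.A *ₑ x + S.B *ₑ u + S.Bw *ₑ w = 0) :
    S.C *ₑ x + S.D *ₑ u + S.Dw *ₑ w = S.Gu *ₑ u + S.Gw *ₑ w := by
  have hCx := congrArg (fun v => S.C *ₑ (S.A⁻¹ *ₑ v)) hx
  simp only [matAct_add, nonsing_inv_matAct hA, matAct_zero] at hCx
  simp only [Plant.Gu, Plant.Gw, matAct_add_matrix, matAct_neg_matrix, matAct_mul]
  linear_combination (norm := module) hCx

end Gains

/-! ### The reduced optimization problem -/

section ReducedProblem

open Set Filter Topology Metric NNReal

variable {n m r nw nc q : ℕ} {S : Plant n m r nw} {O : OSSData m r nw nc}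
  {Tz : Matrix (Fin r) (Fin q) ℝ} {Tu : Matrix (Fin m) (Fin q) ℝ}
  {w : Vec nw} {z z' : Vec r} {u u' : Vec m} {ξ : Vec q}

/-- The domain of the optimization problem in the parameter `ξ` of the feasible points
`(T_z ξ + z, T_u ξ + u)` through a given one. -/
def reducedDomain (O : OSSData m r nw nc) (Tz : Matrix (Fin r) (Fin q) ℝ)
    (Tu : Matrix (Fin m) (Fin q) ℝ) (z : Vec r) (u : Vec m) : Set (Vec q) :=
  {ξ | Tu *ₑ ξ + u ∈ O.U ∧ Tz *ₑ ξ + z ∈ O.Z}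

/-- The objective function on the feasible points `(T_z ξ + z, T_u ξ + u)`, in the parameter
`ξ`. -/
noncomputable def reducedObjective (O : OSSData m r nw nc) (Tz : Matrix (Fin r) (Fin q) ℝ)
    (Tu : Matrix (Fin m) (Fin q) ℝ) (z : Vec r) (u : Vec m) (ξ : Vec q) : ℝ :=
  O.f₀ (Tu *ₑ ξ + u) + O.g₀ (Tz *ₑ ξ + z)

/-- The part of the reduced domain on which the gradients of `f₀` and `g₀` are available. -/
def reducedInterior (O : OSSData m r nw nc) (Tz : Matrix (Fin r) (Fin q) ℝ)
    (Tu : Matrix (Fin m) (Fin q) ℝ) (z : Vec r) (u : Vec m) : Set (Vec q) :=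
  {ξ | Tu *ₑ ξ + u ∈ interior O.U ∧ Tz *ₑ ξ + z ∈ interior O.Z}

/-- The gradient of the objective along the feasible subspace, at a feasible point `(z, u)`; it
drives the slow loop of the controller. -/
noncomputable def reducedGradient (O : OSSData m r nw nc) (Tz : Matrix (Fin r) (Fin q) ℝ)
    (Tu : Matrix (Fin m) (Fin q) ℝ) (z : Vec r) (u : Vec m) : Vec q :=
  Tuᵀ *ₑ gradient O.f₀ u + Tzᵀ *ₑ gradient O.g₀ z

/-- The reduced objective at the disturbance `w` is strongly convex, whatever feasible point is
chosen as the origin of the parametrization. -/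
def IsReducedStronglyConvex (S : Plant n m r nw) (O : OSSData m r nw nc)
    (Tz : Matrix (Fin r) (Fin q) ℝ) (Tu : Matrix (Fin m) (Fin q) ℝ) (w : Vec nw) : Prop :=
  ∀ z u, SteadyStateConstraints S O w z u →
    ∃ κ : ℝ, 0 < κ ∧ StrongConvexOn (reducedDomain O Tz Tu z u) κ (reducedObjective O Tz Tu z u)

theorem SteadyStateConstraints.isReducedStronglyConvex (hT : SpansFeasibleSubspace S O Tz Tu)
    (h : SteadyStateConstraints S O w z u) {κ : ℝ} (hκ : 0 < κ)
    (hconv : StrongConvexOn (reducedDomain O Tz Tu z u) κ (reducedObjective O Tz Tu z u)) :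
    IsReducedStronglyConvex S O Tz Tu w := by
  intro z' u' h'
  obtain ⟨ξ₀, rfl, rfl⟩ := h.exists_eq_shift hT h'
  refine ⟨κ, hκ, ?_⟩
  have hdomain : reducedDomain O Tz Tu (Tz *ₑ ξ₀ + z) (Tu *ₑ ξ₀ + u) =
      (fun ξ => ξ₀ + ξ) ⁻¹' reducedDomain O Tz Tu z u := by
    ext ξ
    simp only [reducedDomain, mem_preimage, mem_ofPred_eq, matAct_add, add_assoc, add_left_comm]
  have hobjective : reducedObjective O Tz Tu (Tz *ₑ ξ₀ + z) (Tu *ₑ ξ₀ + u) =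
      fun ξ => reducedObjective O Tz Tu z u (ξ₀ + ξ) := by
    ext ξ
    simp only [reducedObjective, matAct_add, add_assoc, add_left_comm]
  rw [hdomain, hobjective]
  refine ⟨hconv.1.translate_preimage_right ξ₀, fun x hx y hy a b ha hb hab => ?_⟩
  have hcomb : a • (ξ₀ + x) + b • (ξ₀ + y) = ξ₀ + (a • x + b • y) := by
    rw [smul_add, smul_add, add_add_add_comm, ← add_smul, hab, one_smul]
  simpa only [hcomb, add_sub_add_left_eq_sub] using hconv.2 hx hy ha hb hab

theorem zero_mem_reducedDomain_iff :
    (0 : Vec q) ∈ reducedDomain O Tz Tu z u ↔ u ∈ O.U ∧ z ∈ O.Z := by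
  simp only [reducedDomain, mem_ofPred_eq, matAct_zero, zero_add]

theorem zero_mem_reducedInterior_iff :
    (0 : Vec q) ∈ reducedInterior O Tz Tu z u ↔ u ∈ interior O.U ∧ z ∈ interior O.Z := by
  simp only [reducedInterior, mem_ofPred_eq, matAct_zero, zero_add]

theorem reducedInterior_subset_reducedDomain :
    reducedInterior O Tz Tu z u ⊆ reducedDomain O Tz Tu z u :=
  fun _ h => ⟨interior_subset h.1, interior_subset h.2⟩

theorem isOpen_reducedInterior : IsOpen (reducedInterior O Tz Tu z u) :=
  (isOpen_interior.preimage ((matCLM Tu).continuous.add_const u)).inter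
    (isOpen_interior.preimage ((matCLM Tz).continuous.add_const z))

theorem isOptimal_iff_isMinOn_reducedObjective (hT : SpansFeasibleSubspace S O Tz Tu)
    (h : IsFeasible S O w z u) :
    IsOptimal S O w z u ↔
      IsMinOn (reducedObjective O Tz Tu z u) (reducedDomain O Tz Tu z u) 0 := by
  simp only [IsOptimal, h, true_and, isMinOn_iff, reducedObjective, matAct_zero, zero_add]
  constructor
  · exact fun hopt ξ hξ => hopt _ _ ⟨hξ.2, hξ.1, h.2.2.shift hT ξ⟩
  · intro hmin z' u' h'
    obtain ⟨ξ, rfl, rfl⟩ := h.2.2.exists_eq_shift hT h'.2.2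
    exact hmin ξ ⟨h'.2.1, h'.1⟩

theorem IsOptimal.reducedObjective_lt (hT : SpansFeasibleSubspace S O Tz Tu)
    (hconv : IsReducedStronglyConvex S O Tz Tu w) (hopt : IsOptimal S O w z u)
    (hξ : ξ ∈ reducedDomain O Tz Tu z u) (hξ0 : ξ ≠ 0) :
    reducedObjective O Tz Tu z u 0 < reducedObjective O Tz Tu z u ξ := by
  obtain ⟨κ, hκ, hsc⟩ := hconv z u hopt.1.2.2
  have hmin := (isOptimal_iff_isMinOn_reducedObjective hT hopt.1).1 hopt
  refine (hmin hξ).lt_of_ne fun heq => hξ0 ?_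
  exact (hsc.strictConvexOn hκ).eq_of_isMinOn (fun ξ' hξ' => heq.symm.trans_le (hmin hξ')) hmin hξ
    (zero_mem_reducedDomain_iff.2 ⟨hopt.1.2.1, hopt.1.1⟩)

theorem IsOptimal.eq (hT : SpansFeasibleSubspace S O Tz Tu)
    (hconv : IsReducedStronglyConvex S O Tz Tu w) (hopt : IsOptimal S O w z u)
    (hopt' : IsOptimal S O w z' u') : z' = z ∧ u' = u := by
  obtain ⟨ξ, rfl, rfl⟩ := hopt.1.2.2.exists_eq_shift hT hopt'.1.2.2
  suffices hξ : ξ = 0 by simp only [hξ, matAct_zero, zero_add, and_self]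
  by_contra hξ
  have hlt := hopt.reducedObjective_lt hT hconv (ξ := ξ) ⟨hopt'.1.2.1, hopt'.1.1⟩ hξ
  simp only [reducedObjective, matAct_zero, zero_add] at hlt
  exact hlt.not_ge (hopt'.2 _ _ hopt.1)

/-- The part of the standing assumptions that makes the interior optima regular: smoothness of the
objective in the interiors of the domains, existence of interior optima, and compactness of the set
of disturbances. -/
structure InteriorRegularity (S : Plant n m r nw) (O : OSSData m r nw nc) : Prop where
  differentiableOn_f₀ : DifferentiableOn ℝ O.f₀ (interior O.U)
  differentiableOn_g₀ : DifferentiableOn ℝ O.g₀ (interior O.Z)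
  locallyLipschitz_grad_f₀ : LocallyLipschitzOn (interior O.U) (gradient O.f₀)
  locallyLipschitz_grad_g₀ : LocallyLipschitzOn (interior O.Z) (gradient O.g₀)
  isCompact_W : IsCompact O.W
  exists_optimal : ∀ w ∈ O.W, ∃ z ∈ interior O.Z, ∃ u ∈ interior O.U, IsOptimal S O w z u

theorem StandingAssumptions.interiorRegularity (hO : StandingAssumptions S O) :
    InteriorRegularity S O where
  differentiableOn_f₀ := hO.contDiffOn_f₀.differentiableOn one_ne_zero
  differentiableOn_g₀ := hO.contDiffOn_g₀.differentiableOn one_ne_zero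
  locallyLipschitz_grad_f₀ := hO.locallyLipschitz_grad_f₀
  locallyLipschitz_grad_g₀ := hO.locallyLipschitz_grad_g₀
  isCompact_W := hO.isCompact_W
  exists_optimal := hO.exists_optimal

theorem hasFDerivAt_comp_matAct_add {a b : ℕ} {f : Vec a → ℝ} {M : Matrix (Fin a) (Fin b) ℝ}
    {v : Vec a} {ξ : Vec b} (hf : DifferentiableAt ℝ f (M *ₑ ξ + v)) :
    HasFDerivAt (fun ξ : Vec b => f (M *ₑ ξ + v))
      (innerSL ℝ (Mᵀ *ₑ gradient f (M *ₑ ξ + v))) ξ := by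
  have haffine : HasFDerivAt (fun ξ : Vec b => M *ₑ ξ + v) (matCLM M) ξ :=
    (matCLM M).hasFDerivAt.add_const v
  refine (HasFDerivAt.comp (g := f) ξ hf.hasGradientAt.hasFDerivAt haffine).congr_fderiv ?_
  ext1 ξ'
  rw [innerSL_apply_apply, inner_transpose_matAct]
  rfl

namespace InteriorRegularity

theorem differentiableAt_f₀ (hO : InteriorRegularity S O) (hu : u ∈ interior O.U) :
    DifferentiableAt ℝ O.f₀ u :=
  hO.differentiableOn_f₀.differentiableAt (isOpen_interior.mem_nhds hu)

theorem differentiableAt_g₀ (hO : InteriorRegularity S O) (hz : z ∈ interior O.Z) :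
    DifferentiableAt ℝ O.g₀ z :=
  hO.differentiableOn_g₀.differentiableAt (isOpen_interior.mem_nhds hz)

theorem hasFDerivAt_reducedObjective (hO : InteriorRegularity S O)
    (hξ : ξ ∈ reducedInterior O Tz Tu z u) :
    HasFDerivAt (reducedObjective O Tz Tu z u)
      (innerSL ℝ (reducedGradient O Tz Tu (Tz *ₑ ξ + z) (Tu *ₑ ξ + u))) ξ := by
  rw [reducedGradient, map_add]
  exact (hasFDerivAt_comp_matAct_add (hO.differentiableAt_f₀ hξ.1)).add
    (hasFDerivAt_comp_matAct_add (hO.differentiableAt_g₀ hξ.2))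

theorem isOptimal_iff_reducedGradient_eq_zero (hO : InteriorRegularity S O)
    (hT : SpansFeasibleSubspace S O Tz Tu) (hconv : IsReducedStronglyConvex S O Tz Tu w)
    (h : SteadyStateConstraints S O w z u) (hz : z ∈ interior O.Z) (hu : u ∈ interior O.U) :
    IsOptimal S O w z u ↔ reducedGradient O Tz Tu z u = 0 := by
  have h0 : (0 : Vec q) ∈ reducedInterior O Tz Tu z u := zero_mem_reducedInterior_iff.2 ⟨hu, hz⟩
  have hderiv := hO.hasFDerivAt_reducedObjective h0
  simp only [matAct_zero, zero_add] at hderiv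
  rw [isOptimal_iff_isMinOn_reducedObjective hT ⟨interior_subset hz, interior_subset hu, h⟩]
  constructor
  · intro hmin
    have hlocal := hmin.isLocalMin (mem_of_superset (isOpen_reducedInterior.mem_nhds h0)
      reducedInterior_subset_reducedDomain)
    have hzero := hlocal.hasFDerivAt_eq_zero hderiv
    rwa [← norm_eq_zero, innerSL_apply_norm, norm_eq_zero] at hzero
  · intro hgrad ξ hξ
    obtain ⟨κ, hκ, hsc⟩ := hconv z u h
    have hle := add_fderiv_add_sq_le_of_strongConvexOn hsc
      (reducedInterior_subset_reducedDomain h0) hξ hderiv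
    rw [hgrad, map_zero, _root_.zero_apply, add_zero] at hle
    exact le_trans (le_add_of_nonneg_right (by positivity)) hle

end InteriorRegularity

section DependenceOnDisturbance

theorem exists_closedBall_of_eventually_nhds_prod {W E : Type*} [TopologicalSpace W]
    [NormedAddCommGroup E] {w₀ : W} {p : W × E → Prop} (h : ∀ᶠ x in 𝓝 (w₀, 0), p x) :
    ∃ δ > 0, ∀ᶠ w in 𝓝 w₀, ∀ ξ ∈ closedBall (0 : E) δ, p (w, ξ) := by
  rw [nhds_prod_eq, eventually_prod_iff] at h
  obtain ⟨pw, hpw, pξ, hpξ, hp⟩ := h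
  obtain ⟨δ, hδ, hball⟩ := nhds_basis_closedBall.eventually_iff.1 hpξ
  exact ⟨δ, hδ, hpw.mono fun w hw ξ hξ => hp hw (hball hξ)⟩

theorem eventually_matAct_add_mem {a b k : ℕ} (M : Matrix (Fin a) (Fin b) ℝ)
    (L : Vec k →L[ℝ] Vec a) {v : Vec a} {N : Set (Vec a)} (hN : N ∈ 𝓝 v) (w₀ : Vec k) :
    ∀ᶠ x : Vec k × Vec b in 𝓝 (w₀, 0), M *ₑ x.2 + (v + L (x.1 - w₀)) ∈ N := by
  have hcont : Continuous fun x : Vec k × Vec b => matCLM M x.2 + (v + L (x.1 - w₀)) := by fun_prop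
  exact (hcont.tendsto' (w₀, 0) v (by simp)).eventually_mem hN

theorem InteriorRegularity.continuousAt_reducedObjective (hO : InteriorRegularity S O)
    {Z : Vec nw → Vec r} {U : Vec nw → Vec m} (hZ : Continuous Z) (hU : Continuous U)
    (hξ : ξ ∈ reducedInterior O Tz Tu (Z w) (U w)) :
    ContinuousAt (fun x : Vec nw × Vec q => reducedObjective O Tz Tu (Z x.1) (U x.1) x.2)
      (w, ξ) := by
  have hz : Continuous fun x : Vec nw × Vec q => matCLM Tz x.2 + Z x.1 := by fun_prop
  have hu : Continuous fun x : Vec nw × Vec q => matCLM Tu x.2 + U x.1 := by fun_prop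
  exact (ContinuousAt.comp (x := (w, ξ)) (hO.differentiableAt_f₀ hξ.1).continuousAt
    hu.continuousAt).add
    (ContinuousAt.comp (x := (w, ξ)) (hO.differentiableAt_g₀ hξ.2).continuousAt hz.continuousAt)

/-- On a small sphere around the optimum at `w₀` the reduced objective exceeds its value at the
center, and this persists for nearby disturbances; by convexity the optima then stay inside. -/
theorem InteriorRegularity.eventually_isOptimal_mem (hO : InteriorRegularity S O)
    (hT : SpansFeasibleSubspace S O Tz Tu) (hN : (constraintGain S O).rank = nc)
    (hconv : ∀ w ∈ O.W, IsReducedStronglyConvex S O Tz Tu w) {w₀ : Vec nw} (hw₀ : w₀ ∈ O.W)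
    (hopt : IsOptimal S O w₀ z u) (hz : z ∈ interior O.Z) (hu : u ∈ interior O.U)
    {Nz : Set (Vec r)} (hNz : Nz ∈ 𝓝 z) {Nu : Set (Vec m)} (hNu : Nu ∈ 𝓝 u) :
    ∀ᶠ w in 𝓝[O.W] w₀, ∀ z' u', IsOptimal S O w z' u' → z' ∈ Nz ∧ u' ∈ Nu := by
  obtain ⟨Lz, Lu, hshift⟩ := SteadyStateConstraints.exists_disturbance_shift hN
  let Z (w : Vec nw) : Vec r := z + Lz (w - w₀)
  let U (w : Vec nw) : Vec m := u + Lu (w - w₀)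
  have hZ₀ : Z w₀ = z := by simp [Z]
  have hU₀ : U w₀ = u := by simp [U]
  have hbase (w : Vec nw) : SteadyStateConstraints S O w (Z w) (U w) := hshift w₀ w z u hopt.1.2.2
  obtain ⟨δ, hδ, hnear⟩ := exists_closedBall_of_eventually_nhds_prod
    ((eventually_matAct_add_mem Tz Lz (inter_mem hNz (isOpen_interior.mem_nhds hz)) w₀).and
      (eventually_matAct_add_mem Tu Lu (inter_mem hNu (isOpen_interior.mem_nhds hu)) w₀))
  have hinterior {w : Vec nw} {ξ : Vec q}
      (hmem : Tz *ₑ ξ + Z w ∈ Nz ∩ interior O.Z ∧ Tu *ₑ ξ + U w ∈ Nu ∩ interior O.U) :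
      ξ ∈ reducedInterior O Tz Tu (Z w) (U w) :=
    ⟨hmem.2.2, hmem.1.2⟩
  have hsmall := eventually_forall_norm_lt_of_convexOn (w₀ := w₀) hδ
    (D := fun w => reducedDomain O Tz Tu (Z w) (U w))
    (J := fun w => reducedObjective O Tz Tu (Z w) (U w))
    (fun w hw => let ⟨κ, hκ, hsc⟩ := hconv w hw _ _ (hbase w); (hsc.strictConvexOn hκ).convexOn)
    (fun ξ hξ => hO.continuousAt_reducedObjective (by fun_prop) (by fun_prop)
      (hinterior (hnear.self_of_nhds ξ hξ)))
    (fun ξ hξ => by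
      have hmem := reducedInterior_subset_reducedDomain
        (hinterior (hnear.self_of_nhds ξ (sphere_subset_closedBall hξ)))
      rw [hZ₀, hU₀] at hmem ⊢
      exact hopt.reducedObjective_lt hT (hconv w₀ hw₀) hmem (ne_of_mem_sphere hξ hδ.ne'))
  filter_upwards [hsmall, mem_nhdsWithin_of_mem_nhds hnear] with w hlt hin z' u' hopt'
  obtain ⟨ξ, rfl, rfl⟩ := (hbase w).exists_eq_shift hT hopt'.1.2.2
  have h0 := reducedInterior_subset_reducedDomain (hinterior (hin 0 (mem_closedBall_self hδ.le)))
  have hfeasible : IsFeasible S O w (Z w) (U w) :=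
    have h := zero_mem_reducedDomain_iff.1 h0
    ⟨h.2, h.1, hbase w⟩
  have hle : reducedObjective O Tz Tu (Z w) (U w) ξ ≤ reducedObjective O Tz Tu (Z w) (U w) 0 := by
    simpa only [reducedObjective, matAct_zero, zero_add] using hopt'.2 _ _ hfeasible
  have hξ := hin ξ (mem_closedBall_zero_iff.2 (hlt h0 ξ ⟨hopt'.1.2.1, hopt'.1.1⟩ hle).le)
  exact ⟨hξ.1.1, hξ.2.1⟩

end DependenceOnDisturbance

/-- `(z, u)` is an optimal point in the interiors of the domains, near which the gradients are
Lipschitz. The constant `L` is a parameter because the stability argument needs it to be uniform in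
the disturbance. -/
structure IsRegularOptimal (S : Plant n m r nw) (O : OSSData m r nw nc) (L : ℝ≥0) (w : Vec nw)
    (z : Vec r) (u : Vec m) : Prop where
  isOptimal : IsOptimal S O w z u
  mem_interior_Z : z ∈ interior O.Z
  mem_interior_U : u ∈ interior O.U
  lipschitz_grad_g₀ : ∃ t ∈ 𝓝 z, LipschitzOnWith L (gradient O.g₀) t
  lipschitz_grad_f₀ : ∃ t ∈ 𝓝 u, LipschitzOnWith L (gradient O.f₀) t

theorem IsRegularOptimal.mono {L L' : ℝ≥0} (hLL' : L ≤ L') (h : IsRegularOptimal S O L w z u) :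
    IsRegularOptimal S O L' w z u where
  __ := h
  lipschitz_grad_g₀ := h.lipschitz_grad_g₀.imp fun _ ht => ⟨ht.1, ht.2.weaken hLL'⟩
  lipschitz_grad_f₀ := h.lipschitz_grad_f₀.imp fun _ ht => ⟨ht.1, ht.2.weaken hLL'⟩

namespace InteriorRegularity

theorem exists_eventually_isRegularOptimal (hO : InteriorRegularity S O)
    (hT : SpansFeasibleSubspace S O Tz Tu) (hN : (constraintGain S O).rank = nc)
    (hconv : ∀ w ∈ O.W, IsReducedStronglyConvex S O Tz Tu w) (hw : w ∈ O.W) :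
    ∃ L : ℝ≥0, ∀ᶠ w' in 𝓝[O.W] w, ∃ z u, IsRegularOptimal S O L w' z u := by
  obtain ⟨z, hz, u, hu, hopt⟩ := hO.exists_optimal w hw
  obtain ⟨Lz, tz, htz, hLz⟩ := hO.locallyLipschitz_grad_g₀ hz
  obtain ⟨Lu, tu, htu, hLu⟩ := hO.locallyLipschitz_grad_f₀ hu
  rw [isOpen_interior.nhdsWithin_eq hz] at htz
  rw [isOpen_interior.nhdsWithin_eq hu] at htu
  refine ⟨max Lz Lu, ?_⟩
  filter_upwards [self_mem_nhdsWithin, hO.eventually_isOptimal_mem hT hN hconv hw hopt hz hu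
    (interior_mem_nhds.2 htz) (interior_mem_nhds.2 htu)] with w' hw' hnear
  obtain ⟨z', hz', u', hu', hopt'⟩ := hO.exists_optimal w' hw'
  obtain ⟨htz', htu'⟩ := hnear z' u' hopt'
  exact ⟨z', u', hopt', hz', hu',
    ⟨tz, mem_interior_iff_mem_nhds.1 htz', hLz.weaken (le_max_left _ _)⟩,
    ⟨tu, mem_interior_iff_mem_nhds.1 htu', hLu.weaken (le_max_right _ _)⟩⟩

theorem exists_forall_isRegularOptimal (hO : InteriorRegularity S O)
    (hT : SpansFeasibleSubspace S O Tz Tu) (hN : (constraintGain S O).rank = nc)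
    (hconv : ∀ w ∈ O.W, IsReducedStronglyConvex S O Tz Tu w) :
    ∃ L : ℝ≥0, ∀ w ∈ O.W, ∃ z u, IsRegularOptimal S O L w z u := by
  refine hO.isCompact_W.induction_on
    (p := fun s => ∃ L : ℝ≥0, ∀ w ∈ s, ∃ z u, IsRegularOptimal S O L w z u) ?_ ?_ ?_ ?_
  · exact ⟨0, by simp⟩
  · exact fun s t hst => Exists.imp fun L h w hw => h w (hst hw)
  · rintro s t ⟨L, hs⟩ ⟨L', ht⟩
    refine ⟨max L L', fun w => Or.rec (fun hw => ?_) (fun hw => ?_)⟩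
    · exact (hs w hw).imp fun _ => Exists.imp fun _ h => h.mono (le_max_left L L')
    · exact (ht w hw).imp fun _ => Exists.imp fun _ h => h.mono (le_max_right L L')
  · intro w hw
    obtain ⟨L, h⟩ := hO.exists_eventually_isRegularOptimal hT hN hconv hw
    exact ⟨_, h, L, fun w' hw' => hw'⟩

end InteriorRegularity

end ReducedProblem

/-! ### The closed loop -/

section ClosedLoopEquilibria

variable {n m r nw nc q : ℕ} {S : Plant n m r nw} {O : OSSData m r nw nc}
  {Tz : Matrix (Fin r) (Fin q) ℝ} {Tu : Matrix (Fin m) (Fin q) ℝ}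
  {K₁ : Matrix (Fin m) (Fin q) ℝ} {K₂ : Matrix (Fin m) (Fin nc) ℝ} {P : Matrix (Fin q) (Fin q) ℝ}
  {τ₁ τ₂ : ℝ} {w : Vec nw} {p p' : Vec n × Vec q × Vec nc} {z : Vec r} {u : Vec m}

theorem clField_eq_zero_iff (hA : IsUnit S.A) (hτ₁ : τ₁ ≠ 0) (hτ₂ : τ₂ ≠ 0) :
    clField S O Tz Tu K₁ K₂ τ₁ τ₂ w p = 0 ↔
      S.A *ₑ p.1 + S.B *ₑ clInput K₁ K₂ p + S.Bw *ₑ w = 0 ∧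
      SteadyStateConstraints S O w (clOutput S K₁ K₂ w p) (clInput K₁ K₂ p) ∧
      reducedGradient O Tz Tu (clOutput S K₁ K₂ w p) (clInput K₁ K₂ p) = 0 := by
  simp only [clField, Prod.ext_iff, Prod.fst_zero, Prod.snd_zero, neg_eq_zero, smul_eq_zero,
    inv_eq_zero, hτ₁, hτ₂, false_or, reducedGradient]
  constructor
  · rintro ⟨hx, hη₁, hη₂⟩
    exact ⟨hx, ⟨S.output_eq_of_equilibrium hA hx, hη₂.symm⟩, hη₁⟩
  · rintro ⟨hx, hss, hη₁⟩
    exact ⟨hx, hη₁, hss.2.symm⟩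

theorem isEquilibrium_clField_iff (hA : IsUnit S.A) (hτ₁ : τ₁ ≠ 0) (hτ₂ : τ₂ ≠ 0)
    (hO : InteriorRegularity S O) (hT : SpansFeasibleSubspace S O Tz Tu)
    (hconv : IsReducedStronglyConvex S O Tz Tu w) :
    IsEquilibrium (clField S O Tz Tu K₁ K₂ τ₁ τ₂ w) (clDomain S O K₁ K₂ w) p ↔
      p ∈ clDomain S O K₁ K₂ w ∧ S.A *ₑ p.1 + S.B *ₑ clInput K₁ K₂ p + S.Bw *ₑ w = 0 ∧
      IsOptimal S O w (clOutput S K₁ K₂ w p) (clInput K₁ K₂ p) := by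
  rw [IsEquilibrium, clField_eq_zero_iff hA hτ₁ hτ₂]
  refine and_congr_right fun hp => and_congr_right fun _ => ⟨fun h => ?_, fun hopt => ?_⟩
  · exact (hO.isOptimal_iff_reducedGradient_eq_zero hT hconv h.1 hp.2 hp.1).2 h.2
  · exact ⟨hopt.1.2.2,
      (hO.isOptimal_iff_reducedGradient_eq_zero hT hconv hopt.1.2.2 hp.2 hp.1).1 hopt⟩

theorem exists_isEquilibrium_clField (hA : IsUnit S.A) (hτ₁ : τ₁ ≠ 0) (hτ₂ : τ₂ ≠ 0)
    (hO : InteriorRegularity S O) (hT : SpansFeasibleSubspace S O Tz Tu)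
    (hconv : IsReducedStronglyConvex S O Tz Tu w) (hNK : IsUnit (constraintGain S O * K₂))
    (hP : IsUnit P) (hK₁ : projC (constraintGain S O) K₂ * K₁ = Tu * P)
    (hopt : IsOptimal S O w z u) (hz : z ∈ interior O.Z) (hu : u ∈ interior O.U) :
    ∃ p, IsEquilibrium (clField S O Tz Tu K₁ K₂ τ₁ τ₂ w) (clDomain S O K₁ K₂ w) p ∧
      clOutput S K₁ K₂ w p = z ∧ clInput K₁ K₂ p = u := by
  obtain ⟨η₁, η₂, hη⟩ := gain_surjective hT hNK hP hK₁ u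
  let p : Vec n × Vec q × Vec nc := (-(S.A⁻¹ *ₑ (S.B *ₑ u + S.Bw *ₑ w)), η₁, η₂)
  have hpu : clInput K₁ K₂ p = u := hη
  have hx : S.A *ₑ p.1 + S.B *ₑ clInput K₁ K₂ p + S.Bw *ₑ w = 0 := by
    rw [hpu, matAct_neg, matAct_nonsing_inv hA]
    abel
  have hpz : clOutput S K₁ K₂ w p = z := by
    rw [hopt.1.2.2.1, ← hpu]
    exact S.output_eq_of_equilibrium hA hx
  refine ⟨p, (isEquilibrium_clField_iff hA hτ₁ hτ₂ hO hT hconv).2 ⟨⟨?_, ?_⟩, hx, ?_⟩, hpz, hpu⟩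
  · rwa [hpu]
  · rwa [hpz]
  · rwa [hpu, hpz]

theorem clInput_sub : clInput K₁ K₂ (p' - p) = clInput K₁ K₂ p' - clInput K₁ K₂ p := by
  simp only [clInput, Prod.fst_sub, Prod.snd_sub, matAct_sub]
  abel

theorem eq_of_isEquilibrium_clField (hA : IsUnit S.A) (hτ₁ : τ₁ ≠ 0) (hτ₂ : τ₂ ≠ 0)
    (hO : InteriorRegularity S O) (hT : SpansFeasibleSubspace S O Tz Tu)
    (hTrank : (fromRows Tz Tu).rank = q) (hconv : IsReducedStronglyConvex S O Tz Tu w)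
    (hNK : IsUnit (constraintGain S O * K₂)) (hP : IsUnit P)
    (hK₁ : projC (constraintGain S O) K₂ * K₁ = Tu * P)
    (hp : IsEquilibrium (clField S O Tz Tu K₁ K₂ τ₁ τ₂ w) (clDomain S O K₁ K₂ w) p)
    (hp' : IsEquilibrium (clField S O Tz Tu K₁ K₂ τ₁ τ₂ w) (clDomain S O K₁ K₂ w) p') :
    p' = p := by
  rw [isEquilibrium_clField_iff hA hτ₁ hτ₂ hO hT hconv] at hp hp'
  obtain ⟨-, hx, hopt⟩ := hp
  obtain ⟨-, hx', hopt'⟩ := hp'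
  have hinput : clInput K₁ K₂ p' = clInput K₁ K₂ p := (hopt.eq hT hconv hopt').2
  have hη : clInput K₁ K₂ (p' - p) = 0 := by rw [clInput_sub, hinput, sub_self]
  obtain ⟨hη₁, hη₂⟩ := gain_injective hT hTrank hNK hP hK₁ hη
  have hstate : p'.1 = p.1 := by
    rw [hinput] at hx'
    rw [← nonsing_inv_matAct hA p'.1, ← nonsing_inv_matAct hA p.1]
    congr 1
    linear_combination (norm := module) hx' - hx
  exact Prod.ext hstate (Prod.ext (sub_eq_zero.1 hη₁) (sub_eq_zero.1 hη₂))

end ClosedLoopEquilibria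

section ClosedLoopDeviations

variable {n m r nw nc q : ℕ} {S : Plant n m r nw} {O : OSSData m r nw nc}
  {Tz : Matrix (Fin r) (Fin q) ℝ} {Tu : Matrix (Fin m) (Fin q) ℝ}
  {K₁ : Matrix (Fin m) (Fin q) ℝ} {K₂ : Matrix (Fin m) (Fin nc) ℝ} {P : Matrix (Fin q) (Fin q) ℝ}
  {τ₁ τ₂ : ℝ} {w : Vec nw} {p : Vec n × Vec q × Vec nc}

/-- The three time scales of the closed loop: the slow variable is `P η₁`, the quasi-steady value
of `η₂` is the one for which the engineering constraint is insensitive to `η₁`, and the quasi-steady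
plant state is the one with `A x + B u + B_w w = 0`. -/
noncomputable def closedLoopScales (S : Plant n m r nw) (O : OSSData m r nw nc)
    (K₁ : Matrix (Fin m) (Fin q) ℝ) (K₂ : Matrix (Fin m) (Fin nc) ℝ)
    (P : Matrix (Fin q) (Fin q) ℝ) : ThreeTimeScale (Vec n) (Vec q) (Vec nc) where
  P := matCLM P
  M := matCLM ((constraintGain S O * K₂)⁻¹ * (constraintGain S O * K₁))
  T₁ := matCLM (S.A⁻¹ * S.B * K₁)
  T₂ := matCLM (S.A⁻¹ * S.B * K₂)
  A := matCLM S.A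
  N := matCLM (constraintGain S O * K₂)
  J := matCLM (O.Hz * S.C)

theorem closedLoopScales_fast (d : Vec n × Vec q × Vec nc) :
    (closedLoopScales S O K₁ K₂ P).fast d = d.1 + S.A⁻¹ *ₑ (S.B *ₑ clInput K₁ K₂ d) := by
  simp only [ThreeTimeScale.fast_apply, closedLoopScales, matCLM_apply, clInput, matAct_mul,
    matAct_add]

theorem clInput_eq_of_splitting (hK₁ : projC (constraintGain S O) K₂ * K₁ = Tu * P)
    (d : Vec n × Vec q × Vec nc) :
    clInput K₁ K₂ d = Tu *ₑ (closedLoopScales S O K₁ K₂ P).slow d +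
      K₂ *ₑ (closedLoopScales S O K₁ K₂ P).mid d :=
  gain_splitting hK₁ d.2.1 d.2.2

theorem clInput_eq_add (hK₁ : projC (constraintGain S O) K₂ * K₁ = Tu * P)
    (s p : Vec n × Vec q × Vec nc) :
    clInput K₁ K₂ s = Tu *ₑ (closedLoopScales S O K₁ K₂ P).slow (s - p) + clInput K₁ K₂ p +
      K₂ *ₑ (closedLoopScales S O K₁ K₂ P).mid (s - p) := by
  have hsplit := clInput_eq_of_splitting hK₁ (s - p)
  rw [clInput_sub] at hsplit
  linear_combination (norm := module) hsplit

theorem clOutput_sub (s p : Vec n × Vec q × Vec nc) :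
    clOutput S K₁ K₂ w s - clOutput S K₁ K₂ w p = S.Gu *ₑ clInput K₁ K₂ (s - p) +
      S.C *ₑ (closedLoopScales S O K₁ K₂ P).fast (s - p) := by
  rw [closedLoopScales_fast, clInput_sub]
  simp only [clOutput, Plant.Gu, matAct_add, matAct_sub, matAct_add_matrix, matAct_neg_matrix,
    matAct_mul, Prod.fst_sub]
  module

theorem clOutput_eq_add (hT : SpansFeasibleSubspace S O Tz Tu)
    (hK₁ : projC (constraintGain S O) K₂ * K₁ = Tu * P) (s p : Vec n × Vec q × Vec nc) :
    clOutput S K₁ K₂ w s =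
      Tz *ₑ (closedLoopScales S O K₁ K₂ P).slow (s - p) + clOutput S K₁ K₂ w p +
        ((S.Gu * K₂) *ₑ (closedLoopScales S O K₁ K₂ P).mid (s - p) +
          S.C *ₑ (closedLoopScales S O K₁ K₂ P).fast (s - p)) := by
  have hsplit := clOutput_sub (O := O) (P := P) (S := S) (K₁ := K₁) (K₂ := K₂) (w := w) s p
  rw [clInput_eq_of_splitting hK₁, matAct_add, ← hT.Tz_eq] at hsplit
  rw [matAct_mul]
  linear_combination (norm := module) hsplit

theorem clField_fst_eq (hA : IsUnit S.A) (hp : clField S O Tz Tu K₁ K₂ τ₁ τ₂ w p = 0)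
    (s : Vec n × Vec q × Vec nc) :
    (clField S O Tz Tu K₁ K₂ τ₁ τ₂ w s).1 =
      S.A *ₑ (closedLoopScales S O K₁ K₂ P).fast (s - p) := by
  have hx : S.A *ₑ p.1 + S.B *ₑ clInput K₁ K₂ p + S.Bw *ₑ w = 0 := congrArg Prod.fst hp
  rw [closedLoopScales_fast, clInput_sub, matAct_add, matAct_nonsing_inv hA]
  simp only [clField, Prod.fst_sub, matAct_sub]
  linear_combination (norm := module) hx

theorem clField_snd_snd_eq (hT : SpansFeasibleSubspace S O Tz Tu) (hτ₂ : τ₂ ≠ 0)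
    (hK₁ : projC (constraintGain S O) K₂ * K₁ = Tu * P)
    (hp : clField S O Tz Tu K₁ K₂ τ₁ τ₂ w p = 0) (s : Vec n × Vec q × Vec nc) :
    (clField S O Tz Tu K₁ K₂ τ₁ τ₂ w s).2.2 = -(τ₂⁻¹ •
      ((constraintGain S O * K₂) *ₑ (closedLoopScales S O K₁ K₂ P).mid (s - p) +
        (O.Hz * S.C) *ₑ (closedLoopScales S O K₁ K₂ P).fast (s - p))) := by
  have hconstraint :
      O.Hz *ₑ clOutput S K₁ K₂ w p + O.Hu *ₑ clInput K₁ K₂ p + O.Hw *ₑ w = 0 := by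
    have hη₂ : (clField S O Tz Tu K₁ K₂ τ₁ τ₂ w p).2.2 = 0 := congrArg (fun x => x.2.2) hp
    exact (smul_eq_zero.1 (neg_eq_zero.1 hη₂)).resolve_left (inv_ne_zero hτ₂)
  have hmid : (constraintGain S O * K₂) *ₑ (closedLoopScales S O K₁ K₂ P).mid (s - p) =
      O.Hz *ₑ (S.Gu *ₑ clInput K₁ K₂ (s - p)) + O.Hu *ₑ clInput K₁ K₂ (s - p) := by
    rw [← constraintGain_matAct, clInput_eq_of_splitting hK₁, matAct_add,
      hT.constraintGain_Tu, zero_add, matAct_mul]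
  have houtput := congrArg (fun v => O.Hz *ₑ v)
    (clOutput_sub (S := S) (O := O) (K₁ := K₁) (K₂ := K₂) (P := P) (w := w) s p)
  simp only [matAct_add, matAct_sub] at houtput
  simp only [clField]
  rw [hmid, matAct_mul, clInput_sub, matAct_sub O.Hu]
  rw [clInput_sub] at houtput
  congr 2
  linear_combination (norm := module) houtput + hconstraint

end ClosedLoopDeviations

section ClosedLoopStability

open Set Filter Topology NNReal

variable {n m r nw nc q : ℕ} {S : Plant n m r nw} {O : OSSData m r nw nc}
  {Tz : Matrix (Fin r) (Fin q) ℝ} {Tu : Matrix (Fin m) (Fin q) ℝ}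
  {K₁ : Matrix (Fin m) (Fin q) ℝ} {K₂ : Matrix (Fin m) (Fin nc) ℝ} {P : Matrix (Fin q) (Fin q) ℝ}
  {τ₁ τ₂ : ℝ} {w : Vec nw} {p : Vec n × Vec q × Vec nc} {z : Vec r} {u : Vec m} {K L : ℝ≥0}

theorem exists_lipschitzOnWith_comp_of_contDiffAt {E F G : Type*} [NormedAddCommGroup E]
    [NormedSpace ℝ E] [NormedAddCommGroup F] [NormedSpace ℝ F] [PseudoEMetricSpace G] {f : E → F}
    {g : F → G} {x : E} {t : Set F} (hf : ContDiffAt ℝ 1 f x) (ht : t ∈ 𝓝 (f x))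
    (hg : LipschitzOnWith K g t) :
    ∃ K' : ℝ≥0, ∃ t' ∈ 𝓝 x, LipschitzOnWith K' (fun y => g (f y)) t' := by
  obtain ⟨Kf, tf, htf, hLf⟩ := hf.exists_lipschitzOnWith
  exact ⟨_, tf ∩ f ⁻¹' t, inter_mem htf (hf.continuousAt ht),
    hg.comp (hLf.mono inter_subset_left) fun _ hy => hy.2⟩

theorem lipschitzOnWith_reducedGradient {tz : Set (Vec r)} {tu : Set (Vec m)}
    (hg : LipschitzOnWith L (gradient O.g₀) tz) (hf : LipschitzOnWith L (gradient O.f₀) tu) :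
    LipschitzOnWith (‖matCLM Tuᵀ‖₊ * (L * 1) + ‖matCLM Tzᵀ‖₊ * (L * 1))
      (fun y : Vec r × Vec m => reducedGradient O Tz Tu y.1 y.2) (tz ×ˢ tu) :=
  ((matCLM Tuᵀ).lipschitz.comp_lipschitzOnWith
    (hf.comp LipschitzWith.prod_snd.lipschitzOnWith fun _ hy => hy.2)).add
  ((matCLM Tzᵀ).lipschitz.comp_lipschitzOnWith
    (hg.comp LipschitzWith.prod_fst.lipschitzOnWith fun _ hy => hy.1))

theorem contDiff_clInput : ContDiff ℝ 1 fun s : Vec n × Vec q × Vec nc => clInput K₁ K₂ s := by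
  change ContDiff ℝ 1 fun s : Vec n × Vec q × Vec nc => matCLM K₁ s.2.1 + matCLM K₂ s.2.2
  fun_prop

theorem contDiff_clOutput :
    ContDiff ℝ 1 fun s : Vec n × Vec q × Vec nc => clOutput S K₁ K₂ w s := by
  change ContDiff ℝ 1 fun s : Vec n × Vec q × Vec nc =>
    matCLM S.C s.1 + matCLM S.D (clInput K₁ K₂ s) + S.Dw *ₑ w
  have := contDiff_clInput (n := n) (K₁ := K₁) (K₂ := K₂)
  fun_prop

theorem clDomain_mem_nhds (hp : p ∈ clDomain S O K₁ K₂ w) : clDomain S O K₁ K₂ w ∈ 𝓝 p :=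
  (((isOpen_interior.preimage contDiff_clInput.continuous).inter
    (isOpen_interior.preimage contDiff_clOutput.continuous)).mem_nhds hp)

theorem exists_lipschitzOnWith_clField {t : Set (Vec r × Vec m)}
    (ht : t ∈ 𝓝 (clOutput S K₁ K₂ w p, clInput K₁ K₂ p))
    (hK : LipschitzOnWith K (fun y : Vec r × Vec m => reducedGradient O Tz Tu y.1 y.2) t) :
    ∃ K' : ℝ≥0, ∃ t' ∈ 𝓝 p, LipschitzOnWith K' (clField S O Tz Tu K₁ K₂ τ₁ τ₂ w) t' := by
  have hu := contDiff_clInput (n := n) (K₁ := K₁) (K₂ := K₂)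
  have hz := contDiff_clOutput (S := S) (K₁ := K₁) (K₂ := K₂) (w := w)
  have hx : ContDiff ℝ 1 fun s : Vec n × Vec q × Vec nc =>
      matCLM S.A s.1 + matCLM S.B (clInput K₁ K₂ s) + S.Bw *ₑ w := by fun_prop
  have hη₂ : ContDiff ℝ 1 fun s : Vec n × Vec q × Vec nc =>
      -(τ₂⁻¹ • (matCLM O.Hz (clOutput S K₁ K₂ w s) + matCLM O.Hu (clInput K₁ K₂ s) +
        O.Hw *ₑ w)) := by fun_prop
  obtain ⟨Kx, tx, htx, hLx⟩ := hx.contDiffAt.exists_lipschitzOnWith (x := p)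
  obtain ⟨Kη₂, tη₂, htη₂, hLη₂⟩ := hη₂.contDiffAt.exists_lipschitzOnWith (x := p)
  obtain ⟨Kη₁, tη₁, htη₁, hLη₁⟩ :=
    exists_lipschitzOnWith_comp_of_contDiffAt (hz.prodMk hu).contDiffAt ht hK
  have hLη₁' := (-(τ₁⁻¹ • ContinuousLinearMap.id ℝ (Vec q))).lipschitz.comp_lipschitzOnWith hLη₁
  exact ⟨_, tx ∩ (tη₁ ∩ tη₂), inter_mem htx (inter_mem htη₁ htη₂),
    (hLx.mono inter_subset_left).prodMk
      ((hLη₁'.mono fun _ hs => hs.2.1).prodMk (hLη₂.mono fun _ hs => hs.2.2))⟩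

theorem exists_hasQuadraticGrowthOn_reducedObjective (hO : InteriorRegularity S O)
    (hT : SpansFeasibleSubspace S O Tz Tu) (hconv : IsReducedStronglyConvex S O Tz Tu w)
    (hopt : IsOptimal S O w z u) (hz : z ∈ interior O.Z) (hu : u ∈ interior O.U)
    {t : Set (Vec r × Vec m)} (ht : t ∈ 𝓝 (z, u))
    (hK : LipschitzOnWith K (fun y : Vec r × Vec m => reducedGradient O Tz Tu y.1 y.2) t) :
    ∃ s ∈ 𝓝 (0 : Vec q), ∃ κ ℓ : ℝ, HasQuadraticGrowthOn (reducedObjective O Tz Tu z u)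
      (fun ξ => reducedGradient O Tz Tu (Tz *ₑ ξ + z) (Tu *ₑ ξ + u)) s κ ℓ := by
  obtain ⟨κ, hκ, hsc⟩ := hconv z u hopt.1.2.2
  have h0 : (0 : Vec q) ∈ reducedInterior O Tz Tu z u := zero_mem_reducedInterior_iff.2 ⟨hu, hz⟩
  have hshift : ContDiff ℝ 1 fun ξ : Vec q => (matCLM Tz ξ + z, matCLM Tu ξ + u) := by fun_prop
  have ht0 : t ∈ 𝓝 (matCLM Tz 0 + z, matCLM Tu 0 + u) := by
    simpa only [map_zero, zero_add] using ht
  obtain ⟨ℓ, t', ht', hℓ⟩ := exists_lipschitzOnWith_comp_of_contDiffAt hshift.contDiffAt ht0 hK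
  refine ⟨t' ∩ reducedInterior O Tz Tu z u, inter_mem ht' (isOpen_reducedInterior.mem_nhds h0),
    κ, ℓ, hasQuadraticGrowthOn_of_strongConvexOn hκ hsc
      (inter_subset_right.trans reducedInterior_subset_reducedDomain) ⟨mem_of_mem_nhds ht', h0⟩
      (fun ξ hξ => hO.hasFDerivAt_reducedObjective hξ.2) ?_ (hℓ.mono inter_subset_left)⟩
  simpa only [matAct_zero, zero_add] using
    (hO.isOptimal_iff_reducedGradient_eq_zero hT hconv hopt.1.2.2 hz hu).1 hopt

/-- How strongly deviations of the faster variables from their quasi-steady values perturb output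
and input. -/
noncomputable def signalGain (S : Plant n m r nw) (K₂ : Matrix (Fin m) (Fin nc) ℝ) : ℝ :=
  ‖matCLM K₂‖ + (‖matCLM (S.Gu * K₂)‖ + ‖matCLM S.C‖)

theorem norm_signal_perturbation_le (a : Vec nc) (b : Vec n) :
    ‖((S.Gu * K₂) *ₑ a + S.C *ₑ b, K₂ *ₑ a)‖ ≤ signalGain S K₂ * (‖a‖ + ‖b‖) := by
  have hK₂ := norm_matAct_le K₂ a
  have hGK₂ := norm_matAct_le (S.Gu * K₂) a
  have hC := norm_matAct_le S.C b
  refine norm_prod_le_iff.2 ⟨(norm_add_le_of_le hGK₂ hC).trans ?_, hK₂.trans ?_⟩ <;>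
  · rw [signalGain, ← sub_nonneg]
    ring_nf
    positivity

/-- Moving output and input to their values at vanishing mid and fast deviations turns the slow
velocity into an exact gradient step for the reduced objective, up to a Lipschitz error. -/
theorem eventually_isVelocity_clField (hA : IsUnit S.A) (hτ₂ : τ₂ ≠ 0)
    (hT : SpansFeasibleSubspace S O Tz Tu)
    (hK₁ : projC (constraintGain S O) K₂ * K₁ = Tu * P)
    (hp : clField S O Tz Tu K₁ K₂ τ₁ τ₂ w p = 0) {t : Set (Vec r × Vec m)}
    (ht : t ∈ 𝓝 (clOutput S K₁ K₂ w p, clInput K₁ K₂ p))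
    (hK : LipschitzOnWith K (fun y : Vec r × Vec m => reducedGradient O Tz Tu y.1 y.2) t) :
    ∀ᶠ s in 𝓝 p, (closedLoopScales S O K₁ K₂ P).IsVelocity (K * signalGain S K₂) τ₁ τ₂
      (reducedGradient O Tz Tu
        (Tz *ₑ (closedLoopScales S O K₁ K₂ P).slow (s - p) + clOutput S K₁ K₂ w p)
        (Tu *ₑ (closedLoopScales S O K₁ K₂ P).slow (s - p) + clInput K₁ K₂ p))
      (s - p) (clField S O Tz Tu K₁ K₂ τ₁ τ₂ w s) := by
  set D := closedLoopScales S O K₁ K₂ P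
  have hslow : Continuous fun s : Vec n × Vec q × Vec nc =>
      (matCLM Tz (D.slow (s - p)) + clOutput S K₁ K₂ w p,
        matCLM Tu (D.slow (s - p)) + clInput K₁ K₂ p) := by fun_prop
  have hslow_mem := (hslow.tendsto' p _ (by simp)).eventually_mem ht
  have hmem := (contDiff_clOutput.continuous.prodMk contDiff_clInput.continuous).continuousAt
    |>.eventually_mem ht
  filter_upwards [hslow_mem, hmem] with s hs₀ hs
  refine ⟨clField_fst_eq hA hp s, ⟨_, congrArg (fun v => -(τ₁⁻¹ • v))
    (add_sub_cancel _ _).symm, ?_⟩, clField_snd_snd_eq hT hτ₂ hK₁ hp s⟩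
  have hsignal : (clOutput S K₁ K₂ w s, clInput K₁ K₂ s) -
      (Tz *ₑ D.slow (s - p) + clOutput S K₁ K₂ w p, Tu *ₑ D.slow (s - p) + clInput K₁ K₂ p) =
      ((S.Gu * K₂) *ₑ D.mid (s - p) + S.C *ₑ D.fast (s - p), K₂ *ₑ D.mid (s - p)) := by
    rw [Prod.mk_sub_mk, clOutput_eq_add hT hK₁ s p, clInput_eq_add hK₁ s p, add_sub_cancel_left,
      add_sub_cancel_left]
  calc _ ≤ K * ‖_‖ := hK.norm_sub_le hs hs₀
    _ ≤ K * (signalGain S K₂ * (‖D.mid (s - p)‖ + ‖D.fast (s - p)‖)) := by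
      gcongr
      exact hsignal ▸ norm_signal_perturbation_le _ _
    _ = _ := (mul_assoc _ _ _).symm

theorem exists_forall_isLocallyExpStable_clField (hA : IsHurwitz S.A)
    (hO : InteriorRegularity S O) (hT : SpansFeasibleSubspace S O Tz Tu)
    (hNK : IsHurwitz (-(constraintGain S O * K₂)))
    (hP : ∀ v : Vec q, v ≠ 0 → 0 < inner ℝ v (P *ₑ v))
    (hK₁ : projC (constraintGain S O) K₂ * K₁ = Tu * P) (L : ℝ≥0) :
    ∃ τstar > (0 : ℝ), ∃ ρ > (0 : ℝ), ∀ τ₁ τ₂ : ℝ, τstar < τ₂ → ρ * τ₂ < τ₁ → ∀ w p,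
      IsReducedStronglyConvex S O Tz Tu w →
      IsRegularOptimal S O L w (clOutput S K₁ K₂ w p) (clInput K₁ K₂ p) →
      IsEquilibrium (clField S O Tz Tu K₁ K₂ τ₁ τ₂ w) (clDomain S O K₁ K₂ w) p →
      IsLocallyExpStable (clField S O Tz Tu K₁ K₂ τ₁ τ₂ w) (clDomain S O K₁ K₂ w) p := by
  let D : ThreeTimeScale (Vec n) (Vec q) (Vec nc) := closedLoopScales S O K₁ K₂ P
  let K : ℝ≥0 := ‖matCLM Tuᵀ‖₊ * (L * 1) + ‖matCLM Tzᵀ‖₊ * (L * 1)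
  obtain ⟨μ, hμ, hPμ⟩ := exists_mul_norm_sq_le_inner (matCLM P) hP
  have hQ₂ : ∃ Q, IsLyapunovOperator (-D.N) Q := by
    obtain ⟨Q, hQ⟩ := hNK.exists_isLyapunovOperator
    exact ⟨Q, by rwa [matCLM_neg] at hQ⟩
  have hc : 0 ≤ K * signalGain S K₂ := by unfold signalGain; positivity
  obtain ⟨τstar, hτstar, ρ, hρ, hstable⟩ := D.exists_forall_isLocallyExpStable hc hμ hPμ hQ₂
    hA.exists_isLyapunovOperator
  refine ⟨τstar, hτstar, ρ, hρ, fun τ₁ τ₂ hτ₂ hτ₁ w p hconv hreg hp => ?_⟩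
  obtain ⟨hopt, hz, hu, ⟨tz, htz, hLz⟩, ⟨tu, htu, hLu⟩⟩ := hreg
  have ht := prod_mem_nhds htz htu
  have hK := lipschitzOnWith_reducedGradient (Tz := Tz) (Tu := Tu) hLz hLu
  obtain ⟨s, hs, κ, ℓ, hgrowth⟩ :=
    exists_hasQuadraticGrowthOn_reducedObjective hO hT hconv hopt hz hu ht hK
  exact hstable τ₁ τ₂ hτ₂ hτ₁ _ _ p _ _ s κ ℓ (clDomain_mem_nhds hp.1)
    (exists_lipschitzOnWith_clField ht hK) hs hgrowth
    (eventually_isVelocity_clField hA.isUnit (hτstar.trans hτ₂).ne' hT hK₁ hp.2 ht hK)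

end ClosedLoopStability

theorem theorem2_general {n m r nw nc q : ℕ} (S : Plant n m r nw) (O : OSSData m r nw nc)
    (hA : IsHurwitz S.A) (hO : InteriorRegularity S O)
    (Tz : Matrix (Fin r) (Fin q) ℝ) (Tu : Matrix (Fin m) (Fin q) ℝ)
    (hT : SpansFeasibleSubspace S O Tz Tu)
    (hTrank : (Matrix.fromRows Tz Tu).rank = q)
    (hN : (constraintGain S O).rank = nc)
    (z₀ : Vec nw → Vec r) (u₀ : Vec nw → Vec m)
    (h₀ : ∀ w ∈ O.W, SteadyStateConstraints S O w (z₀ w) (u₀ w))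
    (hconv : ∀ w ∈ O.W, ∃ κ : ℝ, 0 < κ ∧
      StrongConvexOn (reducedDomain O Tz Tu (z₀ w) (u₀ w)) κ
        (reducedObjective O Tz Tu (z₀ w) (u₀ w))) :
    (∃ K₂ : Matrix (Fin m) (Fin nc) ℝ, IsHurwitz (-(constraintGain S O * K₂))) ∧
    ∀ K₂ : Matrix (Fin m) (Fin nc) ℝ, IsHurwitz (-(constraintGain S O * K₂)) →
      ∀ P : Matrix (Fin q) (Fin q) ℝ, (∀ v : Vec q, v ≠ 0 → 0 < inner ℝ v (P *ₑ v)) →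
        (∃ K₁ : Matrix (Fin m) (Fin q) ℝ,
          K₁.rank = q ∧ projC (constraintGain S O) K₂ * K₁ = Tu * P) ∧
        ∀ K₁ : Matrix (Fin m) (Fin q) ℝ, projC (constraintGain S O) K₂ * K₁ = Tu * P →
          ∃ τstar > (0 : ℝ), ∃ ρ > (0 : ℝ), ∀ τ₁ τ₂ : ℝ, τstar < τ₂ → ρ * τ₂ < τ₁ →
            SolvesOSS S O Tz Tu K₁ K₂ τ₁ τ₂ := by
  have hconv' (w : Vec nw) (hw : w ∈ O.W) : IsReducedStronglyConvex S O Tz Tu w :=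
    let ⟨_, hκ, hsc⟩ := hconv w hw; (h₀ w hw).isReducedStronglyConvex hT hκ hsc
  refine ⟨exists_isHurwitz_neg_mul hN, fun K₂ hK₂ P hP => ?_⟩
  have hPu : IsUnit P := isUnit_of_forall_ne_zero_inner_pos hP
  have hNK : IsUnit (constraintGain S O * K₂) := IsUnit.neg_iff _ |>.1 hK₂.isUnit
  refine ⟨exists_slow_gain hT hTrank hPu, fun K₁ hK₁ => ?_⟩
  obtain ⟨L, hL⟩ := hO.exists_forall_isRegularOptimal hT hN hconv'
  obtain ⟨τstar, hτstar, ρ, hρ, hstable⟩ :=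
    exists_forall_isLocallyExpStable_clField hA hO hT hK₂ hP hK₁ L
  refine ⟨τstar, hτstar, ρ, hρ, fun τ₁ τ₂ hτ₂ hτ₁ w hw => ?_⟩
  have hτ₂0 : 0 < τ₂ := hτstar.trans hτ₂
  have hτ₁0 : 0 < τ₁ := (mul_pos hρ hτ₂0).trans hτ₁
  obtain ⟨z, u, hreg⟩ := hL w hw
  obtain ⟨p, hp, rfl, rfl⟩ := exists_isEquilibrium_clField hA.isUnit hτ₁0.ne' hτ₂0.ne' hO hT
    (hconv' w hw) hNK hPu hK₁ hreg.isOptimal hreg.mem_interior_Z hreg.mem_interior_U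
  exact ⟨p, hp, fun p' hp' => eq_of_isEquilibrium_clField hA.isUnit hτ₁0.ne' hτ₂0.ne' hO hT hTrank
    (hconv' w hw) hNK hPu hK₁ hp hp', hstable τ₁ τ₂ hτ₂ hτ₁ w p (hconv' w hw) hreg hp,
    hreg.isOptimal⟩

theorem theorem2 {n m r nw nc q : ℕ} (S : Plant n m r nw) (O : OSSData m r nw nc)
    (hA : IsHurwitz S.A) (hO : StandingAssumptions S O)
    (Tz : Matrix (Fin r) (Fin q) ℝ) (Tu : Matrix (Fin m) (Fin q) ℝ)
    (hT : SpansFeasibleSubspace S O Tz Tu)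
    (hTrank : (Matrix.fromRows Tz Tu).rank = q)
    (hN : (constraintGain S O).rank = nc)
    (z₀ : Vec nw → Vec r) (u₀ : Vec nw → Vec m)
    (h₀ : ∀ w ∈ O.W, SteadyStateConstraints S O w (z₀ w) (u₀ w))
    (hconv : ∀ w ∈ O.W, ∃ κ : ℝ, 0 < κ ∧
      StrongConvexOn {ξ : Vec q | Tu *ₑ ξ + u₀ w ∈ O.U ∧ Tz *ₑ ξ + z₀ w ∈ O.Z} κ
        (fun ξ => O.f₀ (Tu *ₑ ξ + u₀ w) + O.g₀ (Tz *ₑ ξ + z₀ w))) :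
    (∃ K₂ : Matrix (Fin m) (Fin nc) ℝ, IsHurwitz (-(constraintGain S O * K₂))) ∧
    ∀ K₂ : Matrix (Fin m) (Fin nc) ℝ, IsHurwitz (-(constraintGain S O * K₂)) →
      ∀ P : Matrix (Fin q) (Fin q) ℝ, P.PosDef →
        (∃ K₁ : Matrix (Fin m) (Fin q) ℝ,
          K₁.rank = q ∧ projC (constraintGain S O) K₂ * K₁ = Tu * P) ∧
        ∀ K₁ : Matrix (Fin m) (Fin q) ℝ, K₁.rank = q →
          projC (constraintGain S O) K₂ * K₁ = Tu * P →
          ∃ τstar > (0 : ℝ), ∃ ρ > (0 : ℝ), ∀ τ₁ τ₂ : ℝ, τstar < τ₂ → ρ * τ₂ < τ₁ →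
            SolvesOSS S O Tz Tu K₁ K₂ τ₁ τ₂ := by
  obtain ⟨hK₂, h⟩ :=
    theorem2_general S O hA hO.interiorRegularity Tz Tu hT hTrank hN z₀ u₀ h₀ hconv
  exact ⟨hK₂, fun K₂ hNK P hP => (h K₂ hNK P fun _ => inner_matAct_pos_of_posDef hP).imp_right
    fun h K₁ _ => h K₁⟩
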